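/- All modules are left modules unless said otherwise. Let $A,B$ be rings and let $N$ be an $(A,B)$-bimodule such that ${}_AN$ and $N_B$ are projective. Assume that $\Gamma=\begin{pmatrix}A&N\\0&B\end{pmatrix}$ is a Gorenstein ring (left and right Noetherian, with finite injective dimension as a left and as a right module over itself) and that $\mathrm{gl.dim}\,A<\infty$. A $\Gamma$-module is a triple $(U,V,h)$ with $U$ an $A$-module, $V$ a $B$-module and $h:N\otimes_BV\to U$ an $A$-linear map; $(U,0)$ has $h=0$ and $(N\otimes_BV,V)$ has $h=\mathrm{id}$. For a ring $R$, an $R$-module is Gorenstein-projective if it is isomorphic to $\ker d^0$ for an exact sequence $\cdots\to P^{-1}\to P^0\xrightarrow{d^0}P^1\to\cdots$ of projective modules which stays exact under $\mathrm{Hom}_R(-,Q)$ for every projective $Q$. A sequence $K\to M\to L\to0$ or $M\to L\to0$ is $G$-exact if it is exact and stays exact under $\mathrm{Hom}_R(G,-)$ for every Gorenstein-projective $G$. $\mathrm{Add}\,T$ is the class of modules isomorphic to direct summands of direct sums of copies of $T$, and $\mathrm{Gen}_GT$ is the class of modules $M$ admitting a $G$-exact sequence $T_0\to M\to0$ with $T_0\in\mathrm{Add}\,T$.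 For $\theta:G_1\to G_0$ let $D_\theta$ be the class of modules $M$ for which $\mathrm{Hom}_R(\theta,M)$ is surjective; a left $D_\theta$-approximation of $M$ is a map $\varphi:M\to M_0$ with $M_0\in D_\theta$ such that every map from $M$ to a module in $D_\theta$ factors through $\varphi$. A proper Gorenstein-projective presentation of $T$ is a $G$-exact sequence $G_1\xrightarrow{\theta}G_0\to T\to0$ with $G_1,G_0$ Gorenstein-projective. The module $T$ is Gorenstein silting with respect to such a presentation $\theta$ if $\mathrm{Gen}_GT=D_\theta$, and Gorenstein silting if this holds for some $\theta$. Let $X$ be an $A$-module and $Y$ a $B$-module. Then the following are equivalent: (i) there is a proper Gorenstein-projective presentation $\theta$ of $(X,0)\oplus(N\otimes_BY,Y)$ such that (a) $(X,0)\oplus(N\otimes_BY,Y)$ is Gorenstein silting with respect to $\theta$; (b) for every Gorenstein-projective $\Gamma$-module of the form $(P,0)\oplus(N\otimes_BE,E)$ there is a $G$-exact sequence $(P,0)\oplus(N\otimes_BE,E)\xrightarrow{\lambda}(X_0,0)\oplus(N\otimes_BY_0,Y_0)\to(X_{-1},0)\oplus(N\otimes_BY_{-1},Y_{-1})\to0$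 with $X_0,X_{-1}\in\mathrm{Add}\,X$, $Y_0,Y_{-1}\in\mathrm{Add}\,Y$ and $\lambda=\begin{pmatrix}(\phi,0)&0\\0&(\mathrm{Id}_N\otimes\psi,\psi)\end{pmatrix}$ for some $\phi:P\to X_0$ and $\psi:E\to Y_0$, such that $\lambda$ is a left $D_\theta$-approximation. (ii) there are proper Gorenstein-projective presentations $\theta_X$ of $X$ and $\theta_Y$ of $Y$ such that (c) $X$ is Gorenstein silting with respect to $\theta_X$, and $N\otimes_BY\in\mathrm{Gen}_GX$; (d) $Y$ is Gorenstein silting with respect to $\theta_Y$; (e) for each projective $A$-module $P$ there is an exact sequence $P\xrightarrow{\phi}X_0\to X_{-1}\to0$ with $X_0,X_{-1}\in\mathrm{Add}\,X$ such that $\phi$ is a left $D_{\theta_X}$-approximation; (f) for each Gorenstein-projective $B$-module $E$ there is a $G$-exact sequence $E\xrightarrow{\psi}Y_0\to Y_{-1}\to0$ with $Y_0,Y_{-1}\in\mathrm{Add}\,Y$ such that $\psi$ is a left $D_{\theta_Y}$-approximation. Moreover, for any given projective presentation $P_1\xrightarrow{\theta_X}P_0\to X\to0$ and any given proper Gorenstein-projective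 presentation $E_1\xrightarrow{\theta_Y}E_0\to Y\to0$, put $\theta=\begin{pmatrix}(\theta_X,0)&0\\0&(\mathrm{Id}_N\otimes\theta_Y,\theta_Y)\end{pmatrix}:(P_1,0)\oplus(N\otimes_BE_1,E_1)\to(P_0,0)\oplus(N\otimes_BE_0,E_0)$. Then (a) and (b) hold for $\theta$ if and only if (c), (d), (e) and (f) hold for $\theta_X$ and $\theta_Y$. -/

import Mathlib

open scoped TensorProduct

universe u

noncomputable section

/-! ### Relative (Gorenstein) homological notions over a ring -/

section Gorenstein

variable (R : Type u) [Ring R]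

/-- `M` is Gorenstein-projective: `M` is isomorphic to the kernel of `d⁰ : P⁰ → P¹` for an exact
sequence `⋯ → P⁻¹ → P⁰ → P¹ → ⋯` of projective modules that stays exact under `Hom(-, Q)` for every
projective module `Q`. -/
def IsGorensteinProjective (M : Type u) [AddCommGroup M] [Module R M] : Prop :=
  ∃ (P : ℤ → ModuleCat.{u} R) (d : ∀ i : ℤ, P i →ₗ[R] P (i + 1)),
    (∀ i, Module.Projective R (P i)) ∧
    (∀ i, Function.Exact (d i) (d (i + 1))) ∧
    (∀ Q : ModuleCat.{u} R, Module.Projective R Q → ∀ (i : ℤ) (f : P (i + 1) →ₗ[R] Q),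
      f ∘ₗ d i = 0 → ∃ g : P (i + 1 + 1) →ₗ[R] Q, g ∘ₗ d (i + 1) = f) ∧
    Nonempty (M ≃ₗ[R] LinearMap.ker (d 0))

variable {R}

/-- `p : M → L` is a `G`-epimorphism, that is, `M → L → 0` is a `G`-exact sequence: it is exact and
stays exact under `Hom(G, -)` for every Gorenstein-projective module `G`. -/
def IsGEpi {M L : Type u} [AddCommGroup M] [Module R M] [AddCommGroup L] [Module R L]
    (p : M →ₗ[R] L) : Prop :=
  Function.Surjective p ∧
    ∀ G : ModuleCat.{u} R, IsGorensteinProjective R G →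
      ∀ h : G →ₗ[R] L, ∃ k : G →ₗ[R] M, p ∘ₗ k = h

/-- `K → M → L → 0` is a `G`-exact sequence: it is exact and stays exact under `Hom(G, -)` for every
Gorenstein-projective module `G`. -/
def IsGExact {K M L : Type u} [AddCommGroup K] [Module R K] [AddCommGroup M] [Module R M]
    [AddCommGroup L] [Module R L] (f : K →ₗ[R] M) (p : M →ₗ[R] L) : Prop :=
  Function.Exact f p ∧
    (∀ G : ModuleCat.{u} R, IsGorensteinProjective R G →
      ∀ h : G →ₗ[R] M, p ∘ₗ h = 0 → ∃ k : G →ₗ[R] K, f ∘ₗ k = h) ∧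
    IsGEpi p

/-- `G₁ → G₀ → T → 0` is a proper Gorenstein-projective presentation of `T`. -/
def IsProperGPPresentation {G₁ G₀ T : Type u} [AddCommGroup G₁] [Module R G₁] [AddCommGroup G₀]
    [Module R G₀] [AddCommGroup T] [Module R T] (θ : G₁ →ₗ[R] G₀) (π : G₀ →ₗ[R] T) : Prop :=
  IsGorensteinProjective R G₁ ∧ IsGorensteinProjective R G₀ ∧ IsGExact θ π

/-- `M` belongs to the class `D_θ`: the map `Hom(θ, M) : Hom(G₀, M) → Hom(G₁, M)` is onto. -/
def InD {G₁ G₀ : Type u} [AddCommGroup G₁] [Module R G₁] [AddCommGroup G₀] [Module R G₀]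
    (θ : G₁ →ₗ[R] G₀) (M : Type u) [AddCommGroup M] [Module R M] : Prop :=
  ∀ f : G₁ →ₗ[R] M, ∃ g : G₀ →ₗ[R] M, g ∘ₗ θ = f

variable (R) in
/-- `M` belongs to `Add T`: it is isomorphic to a direct summand of a direct sum of copies
of `T`. -/
def InAdd (T M : Type u) [AddCommGroup T] [Module R T] [AddCommGroup M] [Module R M] : Prop :=
  ∃ (I : Type u) (C : ModuleCat.{u} R), Nonempty ((M × C) ≃ₗ[R] (I →₀ T))

variable (R) in
/-- `M` belongs to `Gen_G T`: there is a `G`-exact sequence `T₀ → M → 0` with `T₀ ∈ Add T`. -/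
def InGenG (T M : Type u) [AddCommGroup T] [Module R T] [AddCommGroup M] [Module R M] : Prop :=
  ∃ (T₀ : ModuleCat.{u} R) (p : T₀ →ₗ[R] M), InAdd R T T₀ ∧ IsGEpi p

/-- `T` is Gorenstein silting with respect to `θ`: `G₁ → G₀ → T → 0` is a proper
Gorenstein-projective presentation of `T` and `Gen_G T = D_θ`. The module `T` is Gorenstein silting
when this holds for some `(θ, π)`. -/
def IsGorensteinSiltingWrt {G₁ G₀ T : Type u} [AddCommGroup G₁] [Module R G₁] [AddCommGroup G₀]
    [Module R G₀] [AddCommGroup T] [Module R T] (θ : G₁ →ₗ[R] G₀) (π : G₀ →ₗ[R] T) : Prop :=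
  IsProperGPPresentation θ π ∧ ∀ M : ModuleCat.{u} R, InGenG R T M ↔ InD θ M

/-- `φ : M → M₀` is a left `D_θ`-approximation of `M`. -/
def IsLeftDApprox {G₁ G₀ M M₀ : Type u} [AddCommGroup G₁] [Module R G₁] [AddCommGroup G₀]
    [Module R G₀] [AddCommGroup M] [Module R M] [AddCommGroup M₀] [Module R M₀]
    (θ : G₁ →ₗ[R] G₀) (φ : M →ₗ[R] M₀) : Prop :=
  InD θ M₀ ∧
    ∀ U : ModuleCat.{u} R, InD θ U → ∀ f : M →ₗ[R] U, ∃ g : M₀ →ₗ[R] U, g ∘ₗ φ = f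

/-- For each projective module `P` there is an exact sequence `P → T₀ → T₋₁ → 0` with
`T₀, T₋₁ ∈ Add T` whose first map is a left `D_θ`-approximation. -/
def HasProjApproxSequences {G₁ G₀ : Type u} [AddCommGroup G₁] [Module R G₁] [AddCommGroup G₀]
    [Module R G₀] (T : Type u) [AddCommGroup T] [Module R T] (θ : G₁ →ₗ[R] G₀) : Prop :=
  ∀ P : ModuleCat.{u} R, Module.Projective R P →
    ∃ (T₀ T₁ : ModuleCat.{u} R) (φ : P →ₗ[R] T₀) (p : T₀ →ₗ[R] T₁),
      InAdd R T T₀ ∧ InAdd R T T₁ ∧ Function.Exact φ p ∧ Function.Surjective p ∧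
      IsLeftDApprox θ φ

/-- For each Gorenstein-projective module `E` there is a `G`-exact sequence `E → T₀ → T₋₁ → 0` with
`T₀, T₋₁ ∈ Add T` whose first map is a left `D_θ`-approximation. -/
def HasGPApproxSequences {G₁ G₀ : Type u} [AddCommGroup G₁] [Module R G₁] [AddCommGroup G₀]
    [Module R G₀] (T : Type u) [AddCommGroup T] [Module R T] (θ : G₁ →ₗ[R] G₀) : Prop :=
  ∀ E : ModuleCat.{u} R, IsGorensteinProjective R E →
    ∃ (T₀ T₁ : ModuleCat.{u} R) (ψ : E →ₗ[R] T₀) (p : T₀ →ₗ[R] T₁),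
      InAdd R T T₀ ∧ InAdd R T T₁ ∧ IsGExact ψ p ∧ IsLeftDApprox θ ψ

variable (R)

/-- A Gorenstein (that is, Iwanaga-Gorenstein) ring: left and right Noetherian, with finite
injective dimension as a left and as a right module over itself. -/
def IsGorensteinRing : Prop :=
  IsNoetherianRing R ∧ IsNoetherianRing Rᵐᵒᵖ ∧
    (∃ n : ℕ, CategoryTheory.HasInjectiveDimensionLE (ModuleCat.of R R) n) ∧
    (∃ n : ℕ, CategoryTheory.HasInjectiveDimensionLE (ModuleCat.of Rᵐᵒᵖ R) n)

/-- The (left) global dimension of `R` is finite. -/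
def HasFiniteGlobalDimension : Prop :=
  ∃ n : ℕ, ∀ M : ModuleCat.{u} R, CategoryTheory.HasProjectiveDimensionLE M n

end Gorenstein

/-! ### The tensor product `N ⊗_B Y` of an `(A, B)`-bimodule with a left `B`-module -/

section Tensor

variable (A B N : Type u) [Ring A] [Ring B] [AddCommGroup N] [Module A N] [Module Bᵐᵒᵖ N]

/-- The relations `(n b) ⊗ y = n ⊗ (b y)`. When the two actions on `N` commute, these generators are
stable under `A`, so that their `A`-span is the additive subgroup which they generate. -/
def BTensor.relations (Y : Type u) [AddCommGroup Y] [Module B Y] : Submodule A (N ⊗[ℤ] Y) :=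
  Submodule.span A
    {t | ∃ (n : N) (b : B) (y : Y), t = (MulOpposite.op b • n) ⊗ₜ[ℤ] y - n ⊗ₜ[ℤ] (b • y)}

/-- The left `A`-module `N ⊗_B Y`. -/
def BTensor (Y : Type u) [AddCommGroup Y] [Module B Y] : Type u :=
  (N ⊗[ℤ] Y) ⧸ BTensor.relations A B N Y

instance (Y : Type u) [AddCommGroup Y] [Module B Y] : AddCommGroup (BTensor A B N Y) :=
  inferInstanceAs (AddCommGroup ((N ⊗[ℤ] Y) ⧸ BTensor.relations A B N Y))

instance (Y : Type u) [AddCommGroup Y] [Module B Y] : Module A (BTensor A B N Y) :=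
  inferInstanceAs (Module A ((N ⊗[ℤ] Y) ⧸ BTensor.relations A B N Y))

variable {N} {Y Y' : Type u} [AddCommGroup Y] [Module B Y] [AddCommGroup Y'] [Module B Y']

/-- The element `n ⊗ y` of `N ⊗_B Y`. -/
def BTensor.tmul (n : N) (y : Y) : BTensor A B N Y :=
  (BTensor.relations A B N Y).mkQ (n ⊗ₜ[ℤ] y)

theorem BTensor.tmul_add (n : N) (y y' : Y) :
    BTensor.tmul A B n (y + y') = BTensor.tmul A B n y + BTensor.tmul A B n y' := by
  unfold BTensor.tmul
  rw [TensorProduct.tmul_add, map_add]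
  rfl

theorem BTensor.add_tmul (n n' : N) (y : Y) :
    BTensor.tmul A B (n + n') y = BTensor.tmul A B n y + BTensor.tmul A B n' y := by
  unfold BTensor.tmul
  rw [TensorProduct.add_tmul, map_add]
  rfl

theorem BTensor.smul_tmul (a : A) (n : N) (y : Y) :
    BTensor.tmul A B (a • n) y = a • BTensor.tmul A B n y := by
  unfold BTensor.tmul
  rw [← TensorProduct.smul_tmul', map_smul]
  rfl

theorem BTensor.op_smul_tmul (n : N) (b : B) (y : Y) :
    BTensor.tmul A B (MulOpposite.op b • n) y = BTensor.tmul A B n (b • y) :=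
  (Submodule.Quotient.eq (BTensor.relations A B N Y)).2
    (Submodule.subset_span ⟨n, b, y, rfl⟩)

variable (N)

/-- The `A`-linear map `Id_N ⊗ g : N ⊗_B Y → N ⊗_B Y'` induced by a `B`-linear map `g`. -/
def BTensor.map (g : Y →ₗ[B] Y') : BTensor A B N Y →ₗ[A] BTensor A B N Y' :=
  Submodule.mapQ (BTensor.relations A B N Y) (BTensor.relations A B N Y')
    (TensorProduct.AlgebraTensorModule.map (R := ℤ) (A := A) (LinearMap.id : N →ₗ[A] N)
      g.toAddMonoidHom.toIntLinearMap)
    (by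
      rw [BTensor.relations, Submodule.span_le]
      rintro _ ⟨n, b, y, rfl⟩
      refine Submodule.subset_span ⟨n, b, g y, ?_⟩
      simp)

theorem BTensor.map_tmul (g : Y →ₗ[B] Y') (n : N) (y : Y) :
    BTensor.map A B N g (BTensor.tmul A B n y) = BTensor.tmul A B n (g y) := rfl

end Tensor

/-! ### The triangular matrix ring -/

/-- The underlying set of `Γ = [[A, N], [0, B]]`; the element `⟨a, n, b⟩` is the matrix with rows
`(a, n)` and `(0, b)`. -/
@[ext] structure TriRing (A B N : Type u) : Type u where
  a : A
  n : N
  b : B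

namespace TriRing

variable {A B N : Type u} [Ring A] [Ring B] [AddCommGroup N]

instance : Zero (TriRing A B N) := ⟨⟨0, 0, 0⟩⟩
instance : One (TriRing A B N) := ⟨⟨1, 0, 1⟩⟩
instance : Add (TriRing A B N) := ⟨fun x y => ⟨x.a + y.a, x.n + y.n, x.b + y.b⟩⟩
instance : Neg (TriRing A B N) := ⟨fun x => ⟨-x.a, -x.n, -x.b⟩⟩

@[simp] theorem zero_a : (0 : TriRing A B N).a = 0 := rfl
@[simp] theorem zero_n : (0 : TriRing A B N).n = 0 := rfl
@[simp] theorem zero_b : (0 : TriRing A B N).b = 0 := rfl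
@[simp] theorem one_a : (1 : TriRing A B N).a = 1 := rfl
@[simp] theorem one_n : (1 : TriRing A B N).n = 0 := rfl
@[simp] theorem one_b : (1 : TriRing A B N).b = 1 := rfl
@[simp] theorem add_a (x y : TriRing A B N) : (x + y).a = x.a + y.a := rfl
@[simp] theorem add_n (x y : TriRing A B N) : (x + y).n = x.n + y.n := rfl
@[simp] theorem add_b (x y : TriRing A B N) : (x + y).b = x.b + y.b := rfl
@[simp] theorem neg_a (x : TriRing A B N) : (-x).a = -x.a := rfl
@[simp] theorem neg_n (x : TriRing A B N) : (-x).n = -x.n := rfl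
@[simp] theorem neg_b (x : TriRing A B N) : (-x).b = -x.b := rfl

variable [Module A N] [Module Bᵐᵒᵖ N]

/-- Matrix multiplication. -/
instance : Mul (TriRing A B N) :=
  ⟨fun x y => ⟨x.a * y.a, x.a • y.n + MulOpposite.op y.b • x.n, x.b * y.b⟩⟩

@[simp] theorem mul_a (x y : TriRing A B N) : (x * y).a = x.a * y.a := rfl
@[simp] theorem mul_n (x y : TriRing A B N) :
    (x * y).n = x.a • y.n + MulOpposite.op y.b • x.n := rfl
@[simp] theorem mul_b (x y : TriRing A B N) : (x * y).b = x.b * y.b := rfl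

instance [SMulCommClass A Bᵐᵒᵖ N] : Ring (TriRing A B N) where
  add_assoc x y z := by ext <;> simp [add_assoc]
  zero_add x := by ext <;> simp
  add_zero x := by ext <;> simp
  add_comm x y := by ext <;> simp [add_comm]
  neg_add_cancel x := by ext <;> simp
  nsmul := nsmulRec
  zsmul := zsmulRec
  mul_assoc x y z := by
    ext
    · simp [mul_assoc]
    · simp [mul_smul, add_assoc, smul_comm x.a (MulOpposite.op z.b) y.n]
    · simp [mul_assoc]
  one_mul x := by ext <;> simp
  mul_one x := by ext <;> simp
  zero_mul x := by ext <;> simp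
  mul_zero x := by ext <;> simp
  left_distrib x y z := by
    ext
    · simp [mul_add]
    · simp only [mul_n, add_n, add_b, MulOpposite.op_add, smul_add, add_smul]
      abel
    · simp [mul_add]
  right_distrib x y z := by
    ext
    · simp [add_mul]
    · simp only [mul_n, add_n, add_a, smul_add, add_smul]
      abel
    · simp [add_mul]

end TriRing

/-! ### Modules over the triangular matrix ring, as triples -/

section TriMod

variable {A B N : Type u} [Ring A] [Ring B] [AddCommGroup N] [Module A N] [Module Bᵐᵒᵖ N]
variable {X Y X' Y' : Type u} [AddCommGroup X] [Module A X] [AddCommGroup Y] [Module B Y]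
  [AddCommGroup X'] [Module A X'] [AddCommGroup Y'] [Module B Y']

/-- The `Γ`-module given by the triple `(X, Y, f)` with `f : N ⊗_B Y → X`: its elements are the
columns `(x, y)`, on which the matrix `⟨a, n, b⟩` acts by `(a x + f (n ⊗ y), b y)`. -/
def TriMod (_f : BTensor A B N Y →ₗ[A] X) : Type u := X × Y

instance (f : BTensor A B N Y →ₗ[A] X) : AddCommGroup (TriMod f) :=
  inferInstanceAs (AddCommGroup (X × Y))

instance [SMulCommClass A Bᵐᵒᵖ N] (f : BTensor A B N Y →ₗ[A] X) :
    Module (TriRing A B N) (TriMod f) where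
  smul r m := ((r.a • m.1 + f (BTensor.tmul A B r.n m.2), r.b • m.2) : X × Y)
  one_smul m := by
    have h : f (BTensor.tmul A B (0 : N) m.2) = 0 := by
      have h0 := BTensor.smul_tmul A B (0 : A) (0 : N) m.2
      rw [zero_smul, zero_smul] at h0
      rw [h0, map_zero]
    refine Prod.ext ?_ (one_smul B m.2)
    change (1 : A) • m.1 + f (BTensor.tmul A B (0 : N) m.2) = m.1
    rw [h, one_smul, add_zero]
  mul_smul r s m := by
    refine Prod.ext ?_ (mul_smul r.b s.b m.2)
    change (r.a * s.a) • m.1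
        + f (BTensor.tmul A B (r.a • s.n + MulOpposite.op s.b • r.n) m.2)
      = r.a • (s.a • m.1 + f (BTensor.tmul A B s.n m.2)) + f (BTensor.tmul A B r.n (s.b • m.2))
    rw [BTensor.add_tmul, BTensor.smul_tmul, BTensor.op_smul_tmul, map_add, map_smul, smul_add,
      mul_smul, add_assoc]
  smul_zero r := by
    have h : f (BTensor.tmul A B r.n (0 : Y)) = 0 := by
      have h0 := BTensor.tmul_add A B r.n (0 : Y) 0
      rw [add_zero, left_eq_add] at h0
      rw [h0, map_zero]
    refine Prod.ext ?_ (smul_zero r.b)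
    change r.a • (0 : X) + f (BTensor.tmul A B r.n (0 : Y)) = 0
    rw [h, smul_zero, add_zero]
  smul_add r m m' := by
    refine Prod.ext ?_ (smul_add r.b m.2 m'.2)
    change r.a • (m.1 + m'.1) + f (BTensor.tmul A B r.n (m.2 + m'.2))
      = (r.a • m.1 + f (BTensor.tmul A B r.n m.2))
        + (r.a • m'.1 + f (BTensor.tmul A B r.n m'.2))
    rw [BTensor.tmul_add, map_add, smul_add]
    abel
  add_smul r s m := by
    refine Prod.ext ?_ (add_smul r.b s.b m.2)
    change (r.a + s.a) • m.1 + f (BTensor.tmul A B (r.n + s.n) m.2)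
      = (r.a • m.1 + f (BTensor.tmul A B r.n m.2))
        + (s.a • m.1 + f (BTensor.tmul A B s.n m.2))
    rw [BTensor.add_tmul, map_add, add_smul]
    abel
  zero_smul m := by
    have h : f (BTensor.tmul A B (0 : N) m.2) = 0 := by
      have h0 := BTensor.smul_tmul A B (0 : A) (0 : N) m.2
      rw [zero_smul, zero_smul] at h0
      rw [h0, map_zero]
    refine Prod.ext ?_ (zero_smul B m.2)
    change (0 : A) • m.1 + f (BTensor.tmul A B (0 : N) m.2) = 0
    rw [h, zero_smul, add_zero]

variable [SMulCommClass A Bᵐᵒᵖ N]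

/-- The `Γ`-linear map `(a, b) : (X, Y, f) → (X', Y', f')` given by an `A`-linear map `a` and a
`B`-linear map `b` with `a ∘ f = f' ∘ (Id_N ⊗ b)`. -/
def TriMod.map {f : BTensor A B N Y →ₗ[A] X} {f' : BTensor A B N Y' →ₗ[A] X'}
    (a : X →ₗ[A] X') (b : Y →ₗ[B] Y') (h : a ∘ₗ f = f' ∘ₗ BTensor.map A B N b) :
    TriMod f →ₗ[TriRing A B N] TriMod f' where
  toFun m := ((a m.1, b m.2) : X' × Y')
  map_add' m m' := Prod.ext (map_add a m.1 m'.1) (map_add b m.2 m'.2)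
  map_smul' r m := by
    refine Prod.ext ?_ (map_smul b r.b m.2)
    change a (r.a • m.1 + f (BTensor.tmul A B r.n m.2))
      = r.a • a m.1 + f' (BTensor.tmul A B r.n (b m.2))
    rw [map_add, map_smul, ← BTensor.map_tmul]
    exact congrArg (r.a • a m.1 + ·) (LinearMap.congr_fun h (BTensor.tmul A B r.n m.2))

variable (A B N)

/-- The `Γ`-module `(X, 0)`. -/
abbrev TriZ (X : Type u) [AddCommGroup X] [Module A X] : Type u :=
  TriMod (0 : BTensor A B N PUnit.{u + 1} →ₗ[A] X)

/-- The `Γ`-module `(N ⊗_B Y, Y)`, with the identity as its structure map. -/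
abbrev TriT (Y : Type u) [AddCommGroup Y] [Module B Y] : Type u :=
  TriMod (LinearMap.id : BTensor A B N Y →ₗ[A] BTensor A B N Y)

/-- The `Γ`-linear map `(φ, 0) : (X, 0) → (X', 0)`. -/
abbrev TriZ.map (φ : X →ₗ[A] X') : TriZ A B N X →ₗ[TriRing A B N] TriZ A B N X' :=
  TriMod.map φ LinearMap.id (by rw [LinearMap.comp_zero, LinearMap.zero_comp])

/-- The `Γ`-linear map `(Id_N ⊗ ψ, ψ) : (N ⊗_B Y, Y) → (N ⊗_B Y', Y')`. -/
abbrev TriT.map (ψ : Y →ₗ[B] Y') : TriT A B N Y →ₗ[TriRing A B N] TriT A B N Y' :=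
  TriMod.map (BTensor.map A B N ψ) ψ (by rw [LinearMap.comp_id, LinearMap.id_comp])

/-- The `Γ`-module `(X, 0) ⊕ (N ⊗_B Y, Y)`. -/
abbrev TriSum (X Y : Type u) [AddCommGroup X] [Module A X] [AddCommGroup Y] [Module B Y] :
    Type u :=
  TriZ A B N X × TriT A B N Y

/-- The diagonal `Γ`-linear map
`(X, 0) ⊕ (N ⊗_B Y, Y) → (X', 0) ⊕ (N ⊗_B Y', Y')` with entries `(φ, 0)` and `(Id_N ⊗ ψ, ψ)`. -/
abbrev TriSum.map (φ : X →ₗ[A] X') (ψ : Y →ₗ[B] Y') :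
    TriSum A B N X Y →ₗ[TriRing A B N] TriSum A B N X' Y' :=
  LinearMap.prodMap (TriZ.map A B N φ) (TriT.map A B N ψ)

/-- For every Gorenstein-projective `Γ`-module of the form `(P, 0) ⊕ (N ⊗_B E, E)` there is a
`G`-exact sequence
`(P, 0) ⊕ (N ⊗_B E, E) → (X₀, 0) ⊕ (N ⊗_B Y₀, Y₀) → (X₋₁, 0) ⊕ (N ⊗_B Y₋₁, Y₋₁) → 0`
with `X₀, X₋₁ ∈ Add X` and `Y₀, Y₋₁ ∈ Add Y` whose first map is diagonal and is a left
`D_θ`-approximation. -/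
def HasDiagonalApproxSequences (X Y : Type u) [AddCommGroup X] [Module A X] [AddCommGroup Y]
    [Module B Y] {G₁ G₀ : Type u} [AddCommGroup G₁] [Module (TriRing A B N) G₁]
    [AddCommGroup G₀] [Module (TriRing A B N) G₀] (θ : G₁ →ₗ[TriRing A B N] G₀) : Prop :=
  ∀ (P : ModuleCat.{u} A) (E : ModuleCat.{u} B),
    IsGorensteinProjective (TriRing A B N) (TriSum A B N P E) →
    ∃ (X₀ X₁ : ModuleCat.{u} A) (Y₀ Y₁ : ModuleCat.{u} B) (φ : P →ₗ[A] X₀) (ψ : E →ₗ[B] Y₀)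
      (μ : TriSum A B N X₀ Y₀ →ₗ[TriRing A B N] TriSum A B N X₁ Y₁),
      InAdd A X X₀ ∧ InAdd A X X₁ ∧ InAdd B Y Y₀ ∧ InAdd B Y Y₁ ∧
      IsGExact (TriSum.map A B N φ ψ) μ ∧ IsLeftDApprox θ (TriSum.map A B N φ ψ)

end TriMod

end

/-!
A `Γ`-module is a triple `(U, V, f)` with `f : N ⊗_B V → U`, and `(X, Y) ↦ (X, 0) ⊕ (N ⊗_B Y, Y)` is
left adjoint to the forgetful functor `(U, V, f) ↦ (U, V)` (`TriSum.exists_eq_desc`). The theorem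
holds because every relative notion over `Γ` splits along this adjunction into the absolute notion
over `A` and the Gorenstein notion over `B`.

* The Gorenstein-projective `Γ`-modules are exactly the modules `(P, 0) ⊕ (N ⊗_B E, E)` with `P`
  projective and `E` Gorenstein-projective (`isGorensteinProjective_triSum_iff`,
  `IsGorensteinProjective.exists_equiv_triSum`). The lower component of a complete resolution is a
  complete resolution, because `_A N` is projective (`IsGorensteinProjective.snd`). As `N_B` is flat,
  the structure map of a Gorenstein-projective triple is injective and its cokernel has
  cosyzygies of every order, so that this cokernel is projective by dimension shifting, `A` having
  finite global dimension (`IsGorensteinProjective.projective_coker`).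
* Consequently `G`-exactness over `Γ` is tested componentwise, and amounts to plain exactness over `A`
  and `G`-exactness over `B` (`TriMod.isGEpi_map_iff`, `TriMod.isGExact_map_iff`).
* If `X` generates `N ⊗_B Y`, then `(X, 0) ⊕ (N ⊗_B Y, Y)` generates `(U, V, f)` exactly when `X`
  generates `U` and `Y` generates `V` (`TriSum.inGenG_triMod_iff`). Over `A`, generation means that
  the trace submodule is everything.
* A presentation `θ` of `(X, 0) ⊕ (N ⊗_B Y, Y)` is isomorphic to a triangular matrix with diagonal
  entries `a` and `c`. These present `X` and `Y` (`TriSum.isGExact_components`), and `(U, V, f)`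
  belongs to `D_θ` exactly when `U` belongs to `D_a` and `V` to `D_c`: the off-diagonal entry does not
  matter (`TriSum.inD_triMod_iff`).

Given the last point (`IsComponentwiseD`), the equality `Gen_G T = D_θ` and the approximation
sequences over `Γ` decompose into the corresponding conditions over `A` and `B`
(`IsComponentwiseD.gen_eq_iff`, `IsComponentwiseD.hasDiagonalApproxSequences_iff`). Diagonal
presentations give the second half of the theorem, and the reduction to diagonal entries the first.
-/

noncomputable section

/-! ### The functor `N ⊗_B -` -/

namespace BTensor

section Basic

variable {A B N : Type u} [Ring A] [Ring B] [AddCommGroup N] [Module A N] [Module Bᵐᵒᵖ N]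
variable {Y Y' Y'' : Type u} [AddCommGroup Y] [Module B Y] [AddCommGroup Y'] [Module B Y']
  [AddCommGroup Y''] [Module B Y'']

theorem tmul_zero (n : N) : tmul A B n (0 : Y) = 0 := by
  have h := tmul_add A B n (0 : Y) 0
  rwa [add_zero, left_eq_add] at h

theorem zero_tmul (y : Y) : tmul A B (0 : N) y = 0 := by
  have h := add_tmul A B (0 : N) 0 y
  rwa [add_zero, left_eq_add] at h

@[elab_as_elim]
theorem induction {p : BTensor A B N Y → Prop} (t : BTensor A B N Y)
    (tmul : ∀ n y, p (tmul A B n y)) (add : ∀ s t, p s → p t → p (s + t)) : p t := by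
  obtain ⟨s, rfl⟩ := Submodule.mkQ_surjective _ t
  induction s using TensorProduct.induction_on with
  | zero =>
    have h := tmul 0 0
    rw [tmul_zero] at h
    rwa [map_zero]
  | tmul n y => exact tmul n y
  | add s t hs ht =>
    rw [map_add]
    exact add _ _ hs ht

theorem hom_ext {W : Type*} [AddCommGroup W] [Module A W] {f g : BTensor A B N Y →ₗ[A] W}
    (h : ∀ n y, f (tmul A B n y) = g (tmul A B n y)) : f = g := by
  ext t
  induction t using BTensor.induction with
  | tmul n y => exact h n y
  | add s t hs ht => rw [map_add, map_add, hs, ht]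

@[simp] theorem map_id : map A B N (LinearMap.id : Y →ₗ[B] Y) = LinearMap.id :=
  hom_ext fun _ _ => rfl

theorem map_comp (g : Y' →ₗ[B] Y'') (f : Y →ₗ[B] Y') :
    map A B N (g ∘ₗ f) = map A B N g ∘ₗ map A B N f :=
  hom_ext fun _ _ => rfl

theorem map_map (g : Y' →ₗ[B] Y'') (f : Y →ₗ[B] Y') (t : BTensor A B N Y) :
    map A B N g (map A B N f t) = map A B N (g ∘ₗ f) t := by
  rw [map_comp]; rfl

@[simp] theorem map_zero : map A B N (0 : Y →ₗ[B] Y') = 0 :=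
  hom_ext fun n _ => by
    rw [map_tmul]
    exact tmul_zero n

theorem map_add (f g : Y →ₗ[B] Y') : map A B N (f + g) = map A B N f + map A B N g :=
  hom_ext fun n _ => by
    rw [LinearMap.add_apply, map_tmul, map_tmul, map_tmul, LinearMap.add_apply, tmul_add]

theorem map_surjective {g : Y →ₗ[B] Y'} (hg : Function.Surjective g) :
    Function.Surjective (map A B N g) := by
  intro t
  induction t using BTensor.induction with
  | tmul n y =>
    obtain ⟨x, rfl⟩ := hg y
    exact ⟨tmul A B n x, rfl⟩
  | add s t hs ht =>
    obtain ⟨s, rfl⟩ := hs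
    obtain ⟨t, rfl⟩ := ht
    exact ⟨s + t, LinearMap.map_add _ _ _⟩

theorem subsingleton [Subsingleton Y] : Subsingleton (BTensor A B N Y) := by
  refine subsingleton_of_forall_eq 0 fun t => ?_
  induction t using BTensor.induction with
  | tmul n y => rw [Subsingleton.elim y 0, tmul_zero]
  | add s t hs ht => rw [hs, ht, add_zero]

variable (A B N Y) in
/-- The map `Y^(N) → N ⊗_B Y` sending the `n`-th copy of `y` to `n ⊗ y`. -/
def ofCoords : (N →₀ Y) →+ BTensor A B N Y :=
  Finsupp.liftAddHom fun n => AddMonoidHom.mk' (tmul A B n) (tmul_add A B n)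

theorem ofCoords_mapRange (g : Y →ₗ[B] Y') (z : N →₀ Y) :
    ofCoords A B N Y' (z.mapRange g (LinearMap.map_zero g)) = map A B N g (ofCoords A B N Y z) := by
  induction z using Finsupp.induction_linear with
  | zero => simp
  | add z z' hz hz' =>
    rw [Finsupp.mapRange_add (LinearMap.map_add g), _root_.map_add, hz, hz', _root_.map_add,
      LinearMap.map_add]
  | single n y => simp [ofCoords, map_tmul, Finsupp.sum_single_index, tmul_zero]

end Basic

section Lift

variable {A B N : Type u} [Ring A] [Ring B] [AddCommGroup N] [Module A N] [Module Bᵐᵒᵖ N]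
  [SMulCommClass A Bᵐᵒᵖ N]
variable {Y : Type u} [AddCommGroup Y] [Module B Y]

/-- The additive map on `N ⊗_B Y` induced by a balanced biadditive map. -/
def liftAdd {W : Type*} [AddCommGroup W] (φ : N →+ Y →+ W)
    (h : ∀ n (b : B) y, φ (MulOpposite.op b • n) y = φ n (b • y)) : BTensor A B N Y →+ W :=
  QuotientAddGroup.lift (relations A B N Y).toAddSubgroup
    (TensorProduct.liftAddHom φ fun r n y => by simp) (by
      intro t ht
      -- The additive kernel need not be an `A`-submodule, but the relations are stable under `A`.
      suffices H : ∀ a : A, TensorProduct.liftAddHom φ (fun r n y => by simp) (a • t) = 0 by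
        have := H 1
        rwa [one_smul] at this
      change t ∈ relations A B N Y at ht
      induction ht using Submodule.span_induction with
      | mem t ht =>
        obtain ⟨n, b, y, rfl⟩ := ht
        intro a
        rw [smul_sub, TensorProduct.smul_tmul', TensorProduct.smul_tmul',
          smul_comm a (MulOpposite.op b) n]
        simp [h]
      | zero => intro a; rw [smul_zero, _root_.map_zero]
      | add s t _ _ hs ht => intro a; rw [smul_add, _root_.map_add, hs, ht, add_zero]
      | smul c t _ ht => intro a; rw [← mul_smul]; exact ht _)

@[simp] theorem liftAdd_tmul {W : Type*} [AddCommGroup W] (φ : N →+ Y →+ W)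
    (h : ∀ n (b : B) y, φ (MulOpposite.op b • n) y = φ n (b • y)) (n : N) (y : Y) :
    liftAdd φ h (tmul A B n y) = φ n y := rfl

/-- The `A`-linear map on `N ⊗_B Y` induced by a balanced biadditive map that is `A`-linear in its
first argument. -/
def lift {W : Type*} [AddCommGroup W] [Module A W] (φ : N →+ Y →+ W)
    (h : ∀ n (b : B) y, φ (MulOpposite.op b • n) y = φ n (b • y))
    (hA : ∀ (a : A) n y, φ (a • n) y = a • φ n y) : BTensor A B N Y →ₗ[A] W where
  __ := liftAdd φ h
  map_smul' a t := by
    change liftAdd φ h (a • t) = a • liftAdd φ h t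
    induction t using BTensor.induction with
    | tmul n y => rw [← smul_tmul, liftAdd_tmul, liftAdd_tmul, hA]
    | add s t hs ht => rw [smul_add, _root_.map_add, _root_.map_add, hs, ht, smul_add]

end Lift

section Exact

variable {A B N : Type u} [Ring A] [Ring B] [AddCommGroup N] [Module A N] [Module Bᵐᵒᵖ N]
  [SMulCommClass A Bᵐᵒᵖ N]
variable {Y Y' Y'' : Type u} [AddCommGroup Y] [Module B Y] [AddCommGroup Y'] [Module B Y']
  [AddCommGroup Y''] [Module B Y'']

variable (A Y) in
/-- The map `N ⊗_B Y → Y^(N)` given by the coordinates of elements of `N` with respect to a dual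
basis, encoded as a `B`-linear map `s` from `N` to the free right module on `N`. -/
def coords (s : N →ₗ[Bᵐᵒᵖ] N →₀ Bᵐᵒᵖ) : BTensor A B N Y →+ (N →₀ Y) :=
  liftAdd
    (AddMonoidHom.mk' (fun n => AddMonoidHom.mk'
        (fun y => (s n).mapRange (fun c => c.unop • y) (by simp))
        (fun y y' => by ext i; simp))
      (fun n n' => by ext y i; simp [add_smul]))
    (fun n b y => by ext i; simp [mul_smul])

theorem coords_tmul (s : N →ₗ[Bᵐᵒᵖ] N →₀ Bᵐᵒᵖ) (n : N) (y : Y) :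
    coords A Y s (tmul A B n y) = (s n).mapRange (fun c => c.unop • y) (by simp) := rfl

theorem ofCoords_coords {s : N →ₗ[Bᵐᵒᵖ] N →₀ Bᵐᵒᵖ}
    (hs : ∀ n, Finsupp.linearCombination Bᵐᵒᵖ id (s n) = n) (t : BTensor A B N Y) :
    ofCoords A B N Y (coords A Y s t) = t := by
  induction t using BTensor.induction with
  | tmul n y =>
    rw [coords_tmul]
    conv_rhs => rw [← hs n, Finsupp.linearCombination_apply, Finsupp.sum]
    rw [ofCoords, Finsupp.liftAddHom_apply,
      Finsupp.sum_mapRange_index (by simp [tmul_zero]), Finsupp.sum]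
    have : ∀ S : Finset N, ∀ g : N → N,
        tmul A B (∑ i ∈ S, g i) y = ∑ i ∈ S, tmul A B (g i) y := fun S g =>
      map_sum (AddMonoidHom.mk' (fun n : N => tmul A B n y) fun n n' => add_tmul A B n n' y) g S
    rw [this]
    refine Finset.sum_congr rfl fun i _ => ?_
    exact (op_smul_tmul A B i (s n i).unop y).symm
  | add s t hs ht => rw [_root_.map_add, _root_.map_add, hs, ht]

theorem coords_map (s : N →ₗ[Bᵐᵒᵖ] N →₀ Bᵐᵒᵖ) (g : Y →ₗ[B] Y') (t : BTensor A B N Y) (i : N) :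
    coords A Y' s (map A B N g t) i = g (coords A Y s t i) := by
  induction t using BTensor.induction with
  | tmul n y => simp [map_tmul, coords_tmul]
  | add s t hs ht => simp [hs, ht]

theorem exists_coords (hN : Module.Projective Bᵐᵒᵖ N) :
    ∃ s : N →ₗ[Bᵐᵒᵖ] N →₀ Bᵐᵒᵖ, ∀ n, Finsupp.linearCombination Bᵐᵒᵖ id (s n) = n := hN.out

/-- Since `N_B` is projective, `N ⊗_B -` is a direct summand of the functor `Y ↦ Y^(N)`, and hence
preserves injections. -/
theorem map_injective (hN : Module.Projective Bᵐᵒᵖ N) {g : Y →ₗ[B] Y'}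
    (hg : Function.Injective g) : Function.Injective (map A B N g) := by
  obtain ⟨s, hs⟩ := exists_coords hN
  refine (injective_iff_map_eq_zero _).2 fun t ht => ?_
  have h0 : coords A Y s t = 0 := by
    ext i
    apply hg
    rw [← coords_map, ht, _root_.map_zero, Finsupp.zero_apply, Finsupp.zero_apply,
      LinearMap.map_zero]
  rw [← ofCoords_coords hs t, h0, _root_.map_zero]

/-- Since `N_B` is projective, `N ⊗_B -` is a direct summand of the functor `Y ↦ Y^(N)`, and hence
preserves exactness. -/
theorem map_exact (hN : Module.Projective Bᵐᵒᵖ N) {f : Y →ₗ[B] Y'} {g : Y' →ₗ[B] Y''}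
    (h : Function.Exact f g) : Function.Exact (map A B N f) (map A B N g) := by
  obtain ⟨s, hs⟩ := exists_coords hN
  refine LinearMap.exact_of_comp_of_mem_range ?_ fun t ht => ?_
  · rw [← map_comp, h.linearMap_comp_eq_zero, map_zero]
  · have h0 : ∀ i, ∃ y, f y = coords A Y' s t i := fun i => by
      refine (h _).1 ?_
      rw [← coords_map, ht, _root_.map_zero, Finsupp.zero_apply]
    choose y hy using h0
    classical
    let z : N →₀ Y := Finsupp.onFinset (coords A Y' s t).support
      (fun i => if coords A Y' s t i = 0 then 0 else y i) (by
        intro i hi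
        rw [Finsupp.mem_support_iff]
        exact fun h => hi (if_pos h))
    refine ⟨ofCoords A B N Y z, ?_⟩
    rw [← ofCoords_mapRange, ← ofCoords_coords hs t]
    congr 1
    ext i
    simp only [Finsupp.mapRange_apply, z, Finsupp.onFinset_apply]
    split_ifs with hi
    · rw [hi, LinearMap.map_zero]
    · exact hy i

/-- `N ⊗_B Q` is projective if `Q` and `_A N` are: it is a direct summand of a direct sum of copies
of `N`. -/
theorem projective (hN : Module.Projective A N) (hY : Module.Projective B Y) :
    Module.Projective A (BTensor A B N Y) := by
  obtain ⟨s, hs⟩ := hY.out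
  let i : BTensor A B N Y →ₗ[A] (Y →₀ N) := lift
    (AddMonoidHom.mk' (fun n => AddMonoidHom.mk'
        (fun y => (s y).mapRange (fun c => MulOpposite.op c • n) (by simp))
        (fun y y' => by ext i; simp [add_smul]))
      (fun n n' => by ext y i; simp))
    (fun n b y => by ext i; simp [mul_smul])
    (fun a n y => by ext i; simp [smul_comm a])
  let p : (Y →₀ N) →ₗ[A] BTensor A B N Y := Finsupp.lsum ℕ fun y =>
    { toFun := fun n => tmul A B n y
      map_add' := fun n n' => add_tmul A B n n' y
      map_smul' := fun a n => smul_tmul A B a n y }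
  classical
  have := Module.Projective.of_equiv (finsuppLequivDFinsupp (ι := Y) (M := N) A).symm
  refine Module.Projective.of_split i p (hom_ext fun n y => ?_)
  have hi : i (tmul A B n y) = (s y).mapRange (fun c => MulOpposite.op c • n) (by simp) := rfl
  have hsum : ∀ S : Finset Y, ∀ g : Y → Y,
      tmul A B n (∑ i ∈ S, g i) = ∑ i ∈ S, tmul A B n (g i) := fun S g =>
    map_sum (AddMonoidHom.mk' (tmul A B n) (tmul_add A B n)) g S
  have hy := hs y
  rw [Finsupp.linearCombination_apply, Finsupp.sum] at hy
  rw [LinearMap.comp_apply, hi, LinearMap.id_apply]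
  conv_rhs => rw [← hy]
  rw [hsum, Finsupp.lsum_apply, Finsupp.sum_mapRange_index (by simp [zero_tmul]), Finsupp.sum]
  exact Finset.sum_congr rfl fun j _ => op_smul_tmul A B n (s y j) j

end Exact

end BTensor

/-! ### Gorenstein-projective modules and relative exactness over a ring -/

section Relative

variable {R : Type u} [Ring R]
variable {K K' M M' L L' T G₁ G₀ : Type u} [AddCommGroup K] [Module R K] [AddCommGroup K']
  [Module R K'] [AddCommGroup M] [Module R M] [AddCommGroup M'] [Module R M'] [AddCommGroup L]
  [Module R L] [AddCommGroup L'] [Module R L'] [AddCommGroup T] [Module R T]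
  [AddCommGroup G₁] [Module R G₁] [AddCommGroup G₀] [Module R G₀]

theorem Function.Exact.exists_lift_of_projective [Module.Projective R T] {f : K →ₗ[R] M}
    {p : M →ₗ[R] L} (hfp : Function.Exact f p) (h : T →ₗ[R] M) (hh : p ∘ₗ h = 0) :
    ∃ k : T →ₗ[R] K, f ∘ₗ k = h := by
  obtain ⟨k, hk⟩ := Module.projective_lifting_property f.rangeRestrict
    (h.codRestrict f.range fun t => (hfp _).1 (LinearMap.congr_fun hh t))
    f.surjective_rangeRestrict
  exact ⟨k, LinearMap.ext fun t => congrArg Subtype.val (LinearMap.congr_fun hk t)⟩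

theorem Function.Exact.exists_desc_of_surjective {f : K →ₗ[R] M} {p : M →ₗ[R] L}
    (hfp : Function.Exact f p) (hp : Function.Surjective p) (h : M →ₗ[R] T) (hh : h ∘ₗ f = 0) :
    ∃ k : L →ₗ[R] T, k ∘ₗ p = h := by
  refine ⟨(LinearMap.ker p).liftQ h ?_ ∘ₗ (p.quotKerEquivOfSurjective hp).symm.toLinearMap, ?_⟩
  · rw [hfp.linearMap_ker_eq]
    exact LinearMap.range_le_ker_iff.2 hh
  · ext x
    have : (p.quotKerEquivOfSurjective hp).symm (p x) = (LinearMap.ker p).mkQ x :=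
      (LinearEquiv.symm_apply_eq _).2 rfl
    simp [this]

theorem exact_prodMap {f : K →ₗ[R] M} {p : M →ₗ[R] L} {f' : K' →ₗ[R] M'} {p' : M' →ₗ[R] L'}
    (h : Function.Exact f p) (h' : Function.Exact f' p') :
    Function.Exact (f.prodMap f') (p.prodMap p') := by
  rintro ⟨x, y⟩
  simp only [LinearMap.prodMap_apply, Prod.mk_eq_zero, h x, h' y, Set.mem_range, Prod.exists,
    Prod.mk.injEq]
  exact ⟨fun ⟨⟨a, ha⟩, ⟨b, hb⟩⟩ => ⟨a, b, ha, hb⟩, fun ⟨a, b, ha, hb⟩ => ⟨⟨a, ha⟩, ⟨b, hb⟩⟩⟩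

theorem isGorensteinProjective_iff :
    IsGorensteinProjective R M ↔
      ∃ (P : ℤ → ModuleCat.{u} R) (d : ∀ i : ℤ, P i →ₗ[R] P (i + 1)),
        (∀ i, Module.Projective R (P i)) ∧
        (∀ i, Function.Exact (d i) (d (i + 1))) ∧
        (∀ Q : ModuleCat.{u} R, Module.Projective R Q → ∀ (i : ℤ) (f : P (i + 1) →ₗ[R] Q),
          f ∘ₗ d i = 0 → ∃ g : P (i + 1 + 1) →ₗ[R] Q, g ∘ₗ d (i + 1) = f) ∧
        ∃ ι : M →ₗ[R] P 0, Function.Injective ι ∧ Function.Exact ι (d 0) := by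
  constructor
  · rintro ⟨P, d, hP, hd, hQ, ⟨e⟩⟩
    refine ⟨P, d, hP, hd, hQ, (LinearMap.ker (d 0)).subtype ∘ₗ e.toLinearMap,
      Subtype.val_injective.comp e.injective, fun x => ⟨fun hx => ?_, ?_⟩⟩
    · exact ⟨e.symm ⟨x, hx⟩, by simp⟩
    · rintro ⟨m, rfl⟩
      exact (e m).2
  · rintro ⟨P, d, hP, hd, hQ, ι, hι, hιd⟩
    exact ⟨P, d, hP, hd, hQ, ⟨(LinearEquiv.ofInjective ι hι).trans
      (LinearEquiv.ofEq _ _ hιd.linearMap_ker_eq.symm)⟩⟩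

theorem IsGorensteinProjective.of_equiv (h : IsGorensteinProjective R M) (e : M ≃ₗ[R] M') :
    IsGorensteinProjective R M' := by
  obtain ⟨P, d, hP, hd, hQ, ⟨e'⟩⟩ := h
  exact ⟨P, d, hP, hd, hQ, ⟨e.symm.trans e'⟩⟩

/-- A projective module `M` is the kernel of the endomorphism `(x, y) ↦ (y, 0)` of `M × M`, which
gives a contractible complex. -/
theorem isGorensteinProjective_of_projective (h : Module.Projective R M) :
    IsGorensteinProjective R M := by
  have hd : Function.Exact (LinearMap.inl R M M ∘ₗ LinearMap.snd R M M)
      (LinearMap.inl R M M ∘ₗ LinearMap.snd R M M) := by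
    rintro ⟨x, y⟩
    simp [Prod.ext_iff, eq_comm]
  refine isGorensteinProjective_iff.2 ⟨fun _ => ModuleCat.of R (M × M),
    fun _ => LinearMap.inl R M M ∘ₗ LinearMap.snd R M M, fun _ => ?_, fun _ => hd,
    fun Q _ _ f hf => ⟨f ∘ₗ LinearMap.inr R M M ∘ₗ LinearMap.fst R M M, ?_⟩,
    LinearMap.inl R M M, LinearMap.inl_injective, ?_⟩
  · change Module.Projective R (M × M)
    infer_instance
  · ext x
    · have := LinearMap.congr_fun hf (0, x)
      simp only [LinearMap.comp_apply, LinearMap.snd_apply, LinearMap.inl_apply,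
        LinearMap.zero_apply] at this
      suffices h0 : f (0, 0) = 0 by simpa [this] using h0
      exact LinearMap.map_zero f
    · simp
  · rintro ⟨x, y⟩
    simp [Prod.ext_iff, eq_comm]

theorem IsGorensteinProjective.prod (h : IsGorensteinProjective R M)
    (h' : IsGorensteinProjective R M') : IsGorensteinProjective R (M × M') := by
  obtain ⟨P, d, hP, hd, hQ, ι, hι, hιd⟩ := isGorensteinProjective_iff.1 h
  obtain ⟨P', d', hP', hd', hQ', ι', hι', hιd'⟩ := isGorensteinProjective_iff.1 h'
  refine isGorensteinProjective_iff.2 ⟨fun i => ModuleCat.of R (P i × P' i),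
    fun i => (d i).prodMap (d' i), fun i => ?_, fun i => exact_prodMap (hd i) (hd' i),
    fun Q hQP i f hf => ?_, ι.prodMap ι', hι.prodMap hι', exact_prodMap hιd hιd'⟩
  · change Module.Projective R (P i × P' i)
    infer_instance
  · obtain ⟨g, hg⟩ := hQ Q hQP i (f ∘ₗ LinearMap.inl R _ _) (by
      ext x
      have := LinearMap.congr_fun hf (x, 0)
      simpa using this)
    obtain ⟨g', hg'⟩ := hQ' Q hQP i (f ∘ₗ LinearMap.inr R _ _) (by
      ext x
      have := LinearMap.congr_fun hf (0, x)
      simpa using this)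
    refine ⟨g.coprod g', LinearMap.ext fun x => ?_⟩
    have h1 := LinearMap.congr_fun hg x.1
    have h2 := LinearMap.congr_fun hg' x.2
    simp only [LinearMap.comp_apply, LinearMap.coprod_apply, LinearMap.prodMap_apply] at h1 h2 ⊢
    rw [h1, h2, ← map_add]
    simp

theorem IsGorensteinProjective.exists_coresolution (h : IsGorensteinProjective R M) :
    ∃ (P M' : ModuleCat.{u} R) (ι : M →ₗ[R] P) (p : P →ₗ[R] M'),
      Module.Projective R P ∧ IsGorensteinProjective R M' ∧ Function.Injective ι ∧
      Function.Exact ι p ∧ Function.Surjective p := by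
  obtain ⟨P, d, hP, hd, hQ, ι, hι, hιd⟩ := isGorensteinProjective_iff.1 h
  refine ⟨P 0, ModuleCat.of R (LinearMap.ker (d (0 + 1))), ι,
    (d 0).codRestrict _ fun x => (hd 0).apply_apply_eq_zero x, hP 0,
    ⟨fun i => P (i + 1), fun i => d (i + 1), fun i => hP _, fun i => hd _,
      fun Q hQP i => hQ Q hQP _, ⟨LinearEquiv.refl _ _⟩⟩, hι, fun x => ?_, ?_⟩
  · rw [← hιd x]
    exact Subtype.ext_iff
  · rintro ⟨x, hx⟩
    obtain ⟨y, rfl⟩ := (hd 0 x).1 hx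
    exact ⟨y, rfl⟩

open CategoryTheory in
/-- Dimension shifting: over a ring of finite global dimension, a module all of whose iterated
cosyzygies exist is projective. The cosyzygies are recorded by a class `C` of modules in which each
member embeds into a projective module with cokernel again in `C`. -/
theorem HasFiniteGlobalDimension.projective_of_coresolution (hR : HasFiniteGlobalDimension R)
    (C : ModuleCat.{u} R → Prop)
    (hC : ∀ M, C M → ∃ (P M' : ModuleCat.{u} R) (ι : M →ₗ[R] P) (p : P →ₗ[R] M'),
      Module.Projective R P ∧ C M' ∧ Function.Injective ι ∧ Function.Exact ι p ∧
      Function.Surjective p)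
    (M : ModuleCat.{u} R) (hM : C M) : Module.Projective R M := by
  have key : ∀ n : ℕ, (∀ M, C M → HasProjectiveDimensionLT M (n + 1)) →
      ∀ M, C M → Module.Projective R M := by
    intro n
    induction n with
    | zero =>
      intro h M hM
      have := (projective_iff_hasProjectiveDimensionLT_one (X := M)).2 (h M hM)
      exact (IsProjective.iff_projective M).2 this
    | succ n ih =>
      intro h
      refine ih fun M hM => ?_
      obtain ⟨P, M', ι, p, hP, hM', hι, hιp, hp⟩ := hC M hM
      have hS := ModuleCat.shortComplex_shortExact
        (ModuleCat.shortComplexOfCompEqZero ι p hιp.linearMap_comp_eq_zero) hιp hι hp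
      exact (hS.hasProjectiveDimensionLT_X₃_iff n ((IsProjective.iff_projective P).1 hP)).1
        (h M' hM')
  obtain ⟨n, hn⟩ := hR
  exact key n (fun M _ => hn M) M hM

theorem HasFiniteGlobalDimension.projective_of_isGorensteinProjective
    (hR : HasFiniteGlobalDimension R) (h : IsGorensteinProjective R M) :
    Module.Projective R M :=
  hR.projective_of_coresolution (fun M => IsGorensteinProjective R M)
    (fun _ h => h.exists_coresolution) (ModuleCat.of R M) h

/-! ### `G`-epimorphisms, `G`-exact sequences and approximations -/

theorem IsGEpi.of_rightInverse {p : M →ₗ[R] L} (s : L →ₗ[R] M) (h : p ∘ₗ s = LinearMap.id) :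
    IsGEpi p :=
  ⟨fun l => ⟨s l, LinearMap.congr_fun h l⟩,
    fun _ _ k => ⟨s ∘ₗ k, by rw [← LinearMap.comp_assoc, h, LinearMap.id_comp]⟩⟩

theorem isGEpi_equiv (e : M ≃ₗ[R] L) : IsGEpi e.toLinearMap :=
  .of_rightInverse e.symm.toLinearMap (by ext; simp)

theorem IsGEpi.comp {p : M →ₗ[R] L} {q : K →ₗ[R] M} (hp : IsGEpi p) (hq : IsGEpi q) :
    IsGEpi (p ∘ₗ q) := by
  refine ⟨hp.1.comp hq.1, fun G hG h => ?_⟩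
  obtain ⟨k, rfl⟩ := hp.2 G hG h
  obtain ⟨l, rfl⟩ := hq.2 G hG k
  exact ⟨l, rfl⟩

theorem IsGEpi.congr {p : M →ₗ[R] L} {p' : M' →ₗ[R] L'} (e : M ≃ₗ[R] M') (e' : L ≃ₗ[R] L')
    (h : e'.toLinearMap ∘ₗ p = p' ∘ₗ e.toLinearMap) (hp : IsGEpi p) : IsGEpi p' := by
  have := ((isGEpi_equiv e').comp hp).comp (isGEpi_equiv e.symm)
  rwa [h, LinearMap.comp_assoc, LinearEquiv.comp_symm, LinearMap.comp_id] at this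

theorem IsGExact.congr {f : K →ₗ[R] M} {p : M →ₗ[R] L} {f' : K' →ₗ[R] M'} {p' : M' →ₗ[R] L'}
    (e₁ : K ≃ₗ[R] K') (e₂ : M ≃ₗ[R] M') (e₃ : L ≃ₗ[R] L')
    (hf : e₂.toLinearMap ∘ₗ f = f' ∘ₗ e₁.toLinearMap)
    (hp : e₃.toLinearMap ∘ₗ p = p' ∘ₗ e₂.toLinearMap) (h : IsGExact f p) : IsGExact f' p' := by
  refine ⟨(Function.Exact.iff_of_ladder_linearEquiv hf.symm hp.symm).2 h.1, fun G hG k hk => ?_,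
    h.2.2.congr e₂ e₃ hp⟩
  obtain ⟨l, hl⟩ := h.2.1 G hG (e₂.symm.toLinearMap ∘ₗ k) (by
    ext x
    apply e₃.injective
    have h1 := LinearMap.congr_fun hp (e₂.symm (k x))
    have h2 := LinearMap.congr_fun hk x
    simp only [LinearMap.comp_apply, LinearEquiv.coe_coe, LinearEquiv.apply_symm_apply] at h1 h2 ⊢
    rw [h1, h2]
    simp)
  refine ⟨e₁.toLinearMap ∘ₗ l, ?_⟩
  rw [← LinearMap.comp_assoc, ← hf, LinearMap.comp_assoc, hl]
  ext x
  simp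

theorem IsGExact.surjective {f : K →ₗ[R] M} {p : M →ₗ[R] L} (h : IsGExact f p) :
    Function.Surjective p := h.2.2.1

theorem HasFiniteGlobalDimension.isGEpi_iff (hR : HasFiniteGlobalDimension R) {p : M →ₗ[R] L} :
    IsGEpi p ↔ Function.Surjective p :=
  ⟨fun h => h.1, fun h => ⟨h, fun _ hG k =>
    have := hR.projective_of_isGorensteinProjective hG
    Module.projective_lifting_property p k h⟩⟩

theorem HasFiniteGlobalDimension.isGExact_iff (hR : HasFiniteGlobalDimension R) {f : K →ₗ[R] M}
    {p : M →ₗ[R] L} : IsGExact f p ↔ Function.Exact f p ∧ Function.Surjective p :=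
  ⟨fun h => ⟨h.1, h.surjective⟩, fun h => ⟨h.1, fun _ hG k hk =>
    have := hR.projective_of_isGorensteinProjective hG
    h.1.exists_lift_of_projective k hk, hR.isGEpi_iff.2 h.2⟩⟩

theorem InD.of_equiv {θ : G₁ →ₗ[R] G₀} (h : InD θ M) (e : M ≃ₗ[R] M') : InD θ M' := by
  intro f
  obtain ⟨g, hg⟩ := h (e.symm.toLinearMap ∘ₗ f)
  refine ⟨e.toLinearMap ∘ₗ g, ?_⟩
  rw [LinearMap.comp_assoc, hg]
  ext x
  simp

/-! ### The classes `Add T` and `Gen_G T` -/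

theorem inAdd_iff : InAdd R T M ↔
    ∃ (I : Type u) (s : M →ₗ[R] I →₀ T) (r : (I →₀ T) →ₗ[R] M), r ∘ₗ s = LinearMap.id := by
  constructor
  · rintro ⟨I, C, ⟨e⟩⟩
    exact ⟨I, e.toLinearMap ∘ₗ LinearMap.inl R M C,
      LinearMap.fst R M C ∘ₗ e.symm.toLinearMap, by ext; simp⟩
  · rintro ⟨I, s, r, h⟩
    refine ⟨I, ModuleCat.of R (LinearMap.ker r), ⟨LinearEquiv.ofBijective
      (s.coprod (LinearMap.ker r).subtype) ⟨?_, fun x => ?_⟩⟩⟩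
    · refine (injective_iff_map_eq_zero _).2 ?_
      rintro ⟨m, c, hc⟩ h0
      have hm : m = 0 := by
        have h1 := congrArg r h0
        have h2 := LinearMap.congr_fun h m
        simp only [LinearMap.coprod_apply, map_add, Submodule.subtype_apply, map_zero,
          LinearMap.mem_ker.1 hc, add_zero, LinearMap.comp_apply, LinearMap.id_apply] at h1 h2
        exact h2.symm.trans h1
      subst hm
      have hc0 : c = 0 := by simpa using h0
      subst hc0
      rfl
    · refine ⟨(r x, ⟨x - s (r x), ?_⟩), by simp⟩
      have h2 := LinearMap.congr_fun h (r x)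
      simp only [LinearMap.comp_apply, LinearMap.id_apply] at h2
      rw [LinearMap.mem_ker, map_sub, h2, sub_self]

theorem inAdd_finsupp (I : Type u) : InAdd R T (I →₀ T) :=
  inAdd_iff.2 ⟨I, LinearMap.id, LinearMap.id, rfl⟩

theorem inAdd_punit : InAdd R T PUnit.{u + 1} :=
  inAdd_iff.2 ⟨PUnit, 0, 0, by ext⟩

theorem inGenG_iff : InGenG R T M ↔ ∃ (I : Type u) (p : (I →₀ T) →ₗ[R] M), IsGEpi p := by
  constructor
  · rintro ⟨T₀, p, h, hp⟩
    obtain ⟨I, s, r, hrs⟩ := inAdd_iff.1 h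
    exact ⟨I, p ∘ₗ r, hp.comp (.of_rightInverse s hrs)⟩
  · rintro ⟨I, p, hp⟩
    exact ⟨ModuleCat.of R (I →₀ T), p, inAdd_finsupp I, hp⟩

theorem InAdd.inGenG (h : InAdd R T M) : InGenG R T M :=
  ⟨ModuleCat.of R M, LinearMap.id, h, .of_rightInverse LinearMap.id rfl⟩

theorem inGenG_self : InGenG R T T :=
  inGenG_iff.2 ⟨PUnit, Finsupp.lapply PUnit.unit, .of_rightInverse (Finsupp.lsingle PUnit.unit)
    (by ext; simp)⟩

theorem InGenG.of_equiv (h : InGenG R T M) (e : M ≃ₗ[R] M') : InGenG R T M' := by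
  obtain ⟨T₀, p, hT₀, hp⟩ := h
  exact ⟨T₀, e.toLinearMap ∘ₗ p, hT₀, (isGEpi_equiv e).comp hp⟩

/-- A `G`-epimorphism from a direct sum of copies of `T` may be composed with the projection from a
direct sum over a larger index set. -/
theorem IsGEpi.comp_lcomapDomain {I J : Type u} {p : (I →₀ T) →ₗ[R] M} (hp : IsGEpi p) (k : I → J)
    (hk : Function.Injective k) : IsGEpi (p ∘ₗ Finsupp.lcomapDomain (R := R) k hk) :=
  hp.comp (.of_rightInverse (Finsupp.lmapDomain T R k) (LinearMap.ext fun x => by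
    ext i
    simp [Finsupp.lcomapDomain, Finsupp.mapDomain_apply hk]))

/-- The trace of `T` in `M`: the submodule generated by the images of all maps `T → M`. -/
def traceSubmodule (R T M : Type u) [Ring R] [AddCommGroup T] [Module R T] [AddCommGroup M]
    [Module R M] : Submodule R M := ⨆ g : T →ₗ[R] M, LinearMap.range g

theorem apply_mem_traceSubmodule (g : T →ₗ[R] M) (t : T) : g t ∈ traceSubmodule R T M :=
  (le_iSup (fun g : T →ₗ[R] M => LinearMap.range g) g) ⟨t, rfl⟩

theorem map_traceSubmodule_le (k : M →ₗ[R] M') :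
    (traceSubmodule R T M).map k ≤ traceSubmodule R T M' := by
  rw [traceSubmodule, Submodule.map_iSup]
  refine iSup_le fun g => ?_
  rintro _ ⟨_, ⟨t, rfl⟩, rfl⟩
  exact apply_mem_traceSubmodule (k ∘ₗ g) t

theorem map_mem_traceSubmodule (hM : traceSubmodule R T M = ⊤) (k : M →ₗ[R] M') (m : M) :
    k m ∈ traceSubmodule R T M' :=
  map_traceSubmodule_le k ⟨m, hM ▸ Submodule.mem_top, rfl⟩

theorem finsupp_apply_mem_traceSubmodule {I : Type*} (p : (I →₀ T) →ₗ[R] M) (x : I →₀ T) :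
    p x ∈ traceSubmodule R T M := by
  induction x using Finsupp.induction_linear with
  | zero => rw [map_zero]; exact Submodule.zero_mem _
  | add x y hx hy => rw [map_add]; exact Submodule.add_mem _ hx hy
  | single i t => exact apply_mem_traceSubmodule (p ∘ₗ Finsupp.lsingle i) t

theorem traceSubmodule_eq_top_iff : traceSubmodule R T M = ⊤ ↔
    ∃ (I : Type u) (p : (I →₀ T) →ₗ[R] M), Function.Surjective p := by
  constructor
  · intro h
    refine ⟨T →ₗ[R] M, Finsupp.lsum ℕ fun g => g,
      LinearMap.range_eq_top.1 (top_le_iff.1 (h.ge.trans ?_))⟩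
    refine iSup_le fun g => ?_
    rintro _ ⟨t, rfl⟩
    exact ⟨Finsupp.single g t, by simp⟩
  · rintro ⟨I, p, hp⟩
    refine top_le_iff.1 fun m _ => ?_
    obtain ⟨x, rfl⟩ := hp m
    exact finsupp_apply_mem_traceSubmodule p x

theorem InGenG.traceSubmodule_eq_top (h : InGenG R T M) : traceSubmodule R T M = ⊤ := by
  obtain ⟨I, p, hp⟩ := inGenG_iff.1 h
  exact traceSubmodule_eq_top_iff.2 ⟨I, p, hp.1⟩

theorem HasFiniteGlobalDimension.inGenG_iff (hR : HasFiniteGlobalDimension R) :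
    InGenG R T M ↔ traceSubmodule R T M = ⊤ := by
  simp only [_root_.inGenG_iff, traceSubmodule_eq_top_iff, hR.isGEpi_iff]

end Relative

/-! ### Modules over the triangular matrix ring and their homomorphisms -/

namespace TriMod

variable {A B N : Type u} [Ring A] [Ring B] [AddCommGroup N] [Module A N] [Module Bᵐᵒᵖ N]

section Homs

variable {U V U' V' U'' V'' : Type u} [AddCommGroup U] [Module A U] [AddCommGroup V] [Module B V]
  [AddCommGroup U'] [Module A U'] [AddCommGroup V'] [Module B V']
  [AddCommGroup U''] [Module A U''] [AddCommGroup V''] [Module B V'']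
  {f : BTensor A B N V →ₗ[A] U} {f' : BTensor A B N V' →ₗ[A] U'}
  {f'' : BTensor A B N V'' →ₗ[A] U''}

theorem ext {m m' : TriMod f} (h₁ : m.1 = m'.1) (h₂ : m.2 = m'.2) : m = m' := Prod.ext h₁ h₂

@[simp] theorem add_fst (m m' : TriMod f) : (m + m').1 = m.1 + m'.1 := rfl
@[simp] theorem add_snd (m m' : TriMod f) : (m + m').2 = m.2 + m'.2 := rfl

variable (f) in
/-- The element `(x, 0)` of the triple `(U, V, f)`. -/
def inl (x : U) : TriMod f := ((x, 0) : U × V)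

variable (f) in
/-- The element `(0, y)` of the triple `(U, V, f)`. -/
def inr (y : V) : TriMod f := ((0, y) : U × V)

theorem inl_add (x x' : U) : inl f (x + x') = inl f x + inl f x' := ext rfl (add_zero 0).symm

theorem inr_add (y y' : V) : inr f (y + y') = inr f y + inr f y' := ext (add_zero 0).symm rfl

theorem inl_add_inr (m : TriMod f) : inl f m.1 + inr f m.2 = m := ext (add_zero _) (zero_add _)

theorem comp_compat {a : U →ₗ[A] U'} {b : V →ₗ[B] V'} {a' : U' →ₗ[A] U''} {b' : V' →ₗ[B] V''}
    (h : a ∘ₗ f = f' ∘ₗ BTensor.map A B N b) (h' : a' ∘ₗ f' = f'' ∘ₗ BTensor.map A B N b') :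
    (a' ∘ₗ a) ∘ₗ f = f'' ∘ₗ BTensor.map A B N (b' ∘ₗ b) := by
  rw [BTensor.map_comp, LinearMap.comp_assoc, h, ← LinearMap.comp_assoc, h', LinearMap.comp_assoc]

variable [SMulCommClass A Bᵐᵒᵖ N]

theorem smul_fst (r : TriRing A B N) (m : TriMod f) :
    (r • m).1 = r.a • m.1 + f (BTensor.tmul A B r.n m.2) := rfl

theorem smul_snd (r : TriRing A B N) (m : TriMod f) : (r • m).2 = r.b • m.2 := rfl

@[simp] theorem map_apply_fst (a : U →ₗ[A] U') (b : V →ₗ[B] V')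
    (h : a ∘ₗ f = f' ∘ₗ BTensor.map A B N b) (m : TriMod f) : (map a b h m).1 = a m.1 := rfl

@[simp] theorem map_apply_snd (a : U →ₗ[A] U') (b : V →ₗ[B] V')
    (h : a ∘ₗ f = f' ∘ₗ BTensor.map A B N b) (m : TriMod f) : (map a b h m).2 = b m.2 := rfl

theorem map_inj {a a' : U →ₗ[A] U'} {b b' : V →ₗ[B] V'}
    {h : a ∘ₗ f = f' ∘ₗ BTensor.map A B N b} {h' : a' ∘ₗ f = f' ∘ₗ BTensor.map A B N b'} :
    map a b h = map a' b' h' ↔ a = a' ∧ b = b' := by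
  refine ⟨fun H => ⟨LinearMap.ext fun x => ?_, LinearMap.ext fun y => ?_⟩, ?_⟩
  · exact congrArg Prod.fst (LinearMap.congr_fun H ((x, 0) : U × V))
  · exact congrArg Prod.snd (LinearMap.congr_fun H ((0, y) : U × V))
  · rintro ⟨rfl, rfl⟩
    rfl

theorem map_comp_map_eq_iff {a : U →ₗ[A] U'} {b : V →ₗ[B] V'} {a' : U' →ₗ[A] U''}
    {b' : V' →ₗ[B] V''} {a'' : U →ₗ[A] U''} {b'' : V →ₗ[B] V''}
    {h : a ∘ₗ f = f' ∘ₗ BTensor.map A B N b} {h' : a' ∘ₗ f' = f'' ∘ₗ BTensor.map A B N b'}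
    {h'' : a'' ∘ₗ f = f'' ∘ₗ BTensor.map A B N b''} :
    map a' b' h' ∘ₗ map a b h = map a'' b'' h'' ↔ a' ∘ₗ a = a'' ∧ b' ∘ₗ b = b'' :=
  map_inj (h := comp_compat h h')

theorem smul_inl (r : TriRing A B N) (x : U) : r • inl f x = inl f (r.a • x) := by
  refine ext ?_ (smul_zero _)
  change r.a • x + f (BTensor.tmul A B r.n 0) = r.a • x
  rw [BTensor.tmul_zero, LinearMap.map_zero, add_zero]

theorem smul_inr (r : TriRing A B N) (y : V) :
    r • inr f y = inl f (f (BTensor.tmul A B r.n y)) + inr f (r.b • y) := by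
  refine ext ?_ (zero_add _).symm
  change r.a • (0 : U) + f (BTensor.tmul A B r.n y) = f (BTensor.tmul A B r.n y) + 0
  rw [smul_zero, zero_add, add_zero]

/-- The `Γ`-linear maps between modules in triple form are the pairs of compatible maps. -/
theorem exists_eq_map (g : TriMod f →ₗ[TriRing A B N] TriMod f') :
    ∃ (a : U →ₗ[A] U') (b : V →ₗ[B] V') (h : a ∘ₗ f = f' ∘ₗ BTensor.map A B N b),
      g = map a b h := by
  have hl : ∀ c x, inl f (c • x) = (⟨c, 0, 0⟩ : TriRing A B N) • inl f x := fun c x =>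
    (smul_inl ⟨c, 0, 0⟩ x).symm
  have hr : ∀ c y, inr f (c • y) = (⟨0, 0, c⟩ : TriRing A B N) • inr f y := fun c y => by
    rw [smul_inr, BTensor.zero_tmul, LinearMap.map_zero]
    exact ext (add_zero 0).symm (zero_add _).symm
  have hgl : ∀ x, (g (inl f x)).2 = 0 := fun x => by
    rw [← one_smul A x, hl, LinearMap.map_smul, smul_snd, zero_smul]
  have hgr : ∀ y, (g (inr f y)).1 = 0 := fun y => by
    rw [← one_smul B y, hr, LinearMap.map_smul, smul_fst, zero_smul, BTensor.zero_tmul,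
      LinearMap.map_zero, zero_add]
  let a : U →ₗ[A] U' :=
    { toFun := fun x => (g (inl f x)).1
      map_add' := fun x x' => by rw [inl_add, LinearMap.map_add, add_fst]
      map_smul' := fun c x => by
        rw [hl, LinearMap.map_smul, smul_fst, BTensor.zero_tmul, LinearMap.map_zero, add_zero]
        rfl }
  let b : V →ₗ[B] V' :=
    { toFun := fun y => (g (inr f y)).2
      map_add' := fun y y' => by rw [inr_add, LinearMap.map_add, add_snd]
      map_smul' := fun c y => by
        rw [hr, LinearMap.map_smul, smul_snd]
        rfl }
  refine ⟨a, b, BTensor.hom_ext fun n y => ?_, LinearMap.ext fun m => ?_⟩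
  · have h1 : inl f (f (BTensor.tmul A B n y)) = (⟨0, n, 0⟩ : TriRing A B N) • inr f y := by
      rw [smul_inr, zero_smul]
      exact (add_zero _).symm
    change (g (inl f (f (BTensor.tmul A B n y)))).1 =
      f' (BTensor.map A B N b (BTensor.tmul A B n y))
    rw [h1, LinearMap.map_smul, smul_fst, zero_smul, zero_add, BTensor.map_tmul]
    rfl
  · have hm : g m = g (inl f m.1) + g (inr f m.2) := by rw [← LinearMap.map_add, inl_add_inr]
    rw [hm]
    refine ext ?_ ?_
    · rw [add_fst, hgr, add_zero]
      rfl
    · rw [add_snd, hgl, zero_add]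
      rfl

theorem map_surjective_iff {a : U →ₗ[A] U'} {b : V →ₗ[B] V'}
    {h : a ∘ₗ f = f' ∘ₗ BTensor.map A B N b} :
    Function.Surjective (map a b h) ↔ Function.Surjective a ∧ Function.Surjective b := by
  refine ⟨fun H => ⟨fun x => ?_, fun y => ?_⟩, fun H m => ?_⟩
  · obtain ⟨m, hm⟩ := H ((x, 0) : U' × V')
    exact ⟨m.1, congrArg Prod.fst hm⟩
  · obtain ⟨m, hm⟩ := H ((0, y) : U' × V')
    exact ⟨m.2, congrArg Prod.snd hm⟩
  · obtain ⟨x, hx⟩ := H.1 m.1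
    obtain ⟨y, hy⟩ := H.2 m.2
    exact ⟨((x, y) : U × V), ext hx hy⟩

theorem map_injective_iff {a : U →ₗ[A] U'} {b : V →ₗ[B] V'}
    {h : a ∘ₗ f = f' ∘ₗ BTensor.map A B N b} :
    Function.Injective (map a b h) ↔ Function.Injective a ∧ Function.Injective b := by
  refine ⟨fun H => ⟨fun x x' hx => ?_, fun y y' hy => ?_⟩, fun H m m' hm => ?_⟩
  · exact congrArg Prod.fst (@H ((x, 0) : U × V) ((x', 0) : U × V) (ext hx rfl))
  · exact congrArg Prod.snd (@H ((0, y) : U × V) ((0, y') : U × V) (ext rfl hy))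
  · exact ext (H.1 (congrArg Prod.fst hm)) (H.2 (congrArg Prod.snd hm))

theorem map_exact_iff {a : U →ₗ[A] U'} {b : V →ₗ[B] V'}
    {h : a ∘ₗ f = f' ∘ₗ BTensor.map A B N b} {a' : U' →ₗ[A] U''} {b' : V' →ₗ[B] V''}
    {h' : a' ∘ₗ f' = f'' ∘ₗ BTensor.map A B N b'} :
    Function.Exact (map a b h) (map a' b' h') ↔ Function.Exact a a' ∧ Function.Exact b b' := by
  refine ⟨fun H => ⟨fun x => ⟨fun hx => ?_, ?_⟩, fun y => ⟨fun hy => ?_, ?_⟩⟩,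
    fun H m => ⟨fun hm => ?_, ?_⟩⟩
  · obtain ⟨m, hm⟩ := (H ((x, 0) : U' × V')).1 (ext hx (LinearMap.map_zero b'))
    exact ⟨m.1, congrArg Prod.fst hm⟩
  · rintro ⟨u, rfl⟩
    exact congrArg Prod.fst ((H ((a u, 0) : U' × V')).2
      ⟨((u, 0) : U × V), ext rfl (LinearMap.map_zero b)⟩)
  · obtain ⟨m, hm⟩ := (H ((0, y) : U' × V')).1 (ext (LinearMap.map_zero a') hy)
    exact ⟨m.2, congrArg Prod.snd hm⟩
  · rintro ⟨v, rfl⟩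
    exact congrArg Prod.snd ((H ((0, b v) : U' × V')).2
      ⟨((0, v) : U × V), ext (LinearMap.map_zero a) rfl⟩)
  · obtain ⟨u, hu⟩ := (H.1 m.1).1 (congrArg Prod.fst hm)
    obtain ⟨v, hv⟩ := (H.2 m.2).1 (congrArg Prod.snd hm)
    exact ⟨((u, v) : U × V), ext hu hv⟩
  · rintro ⟨l, rfl⟩
    exact ext (H.1.apply_apply_eq_zero l.1) (H.2.apply_apply_eq_zero l.2)

end Homs

/-! ### Every module over the triangular matrix ring is a triple -/

section Decomposition

variable [SMulCommClass A Bᵐᵒᵖ N]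

variable (A B N) in
/-- The `A`-module `e₁ M` for a `Γ`-module `M`, where `e₁` is the idempotent `⟨1, 0, 0⟩`. -/
def Upper (M : Type u) [AddCommGroup M] [Module (TriRing A B N) M] : Type u :=
  ({ carrier := {m | (⟨1, 0, 0⟩ : TriRing A B N) • m = m}
     zero_mem' := smul_zero _
     add_mem' := fun {x y} (hx : _ = _) (hy : _ = _) => by
      rw [Set.mem_ofPred_eq, smul_add, hx, hy]
     neg_mem' := fun {x} (hx : _ = _) => by rw [Set.mem_ofPred_eq, smul_neg, hx] } :
    AddSubgroup M)

variable (A B N) in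
/-- The `B`-module `e₂ M` for a `Γ`-module `M`, where `e₂` is the idempotent `⟨0, 0, 1⟩`. -/
def Lower (M : Type u) [AddCommGroup M] [Module (TriRing A B N) M] : Type u :=
  ({ carrier := {m | (⟨0, 0, 1⟩ : TriRing A B N) • m = m}
     zero_mem' := smul_zero _
     add_mem' := fun {x y} (hx : _ = _) (hy : _ = _) => by
      rw [Set.mem_ofPred_eq, smul_add, hx, hy]
     neg_mem' := fun {x} (hx : _ = _) => by rw [Set.mem_ofPred_eq, smul_neg, hx] } :
    AddSubgroup M)

variable (M : Type u) [AddCommGroup M] [Module (TriRing A B N) M]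

instance : AddCommGroup (Upper A B N M) := by unfold Upper; infer_instance
instance : AddCommGroup (Lower A B N M) := by unfold Lower; infer_instance

instance : Module A (Upper A B N M) where
  smul a m := ⟨(⟨a, 0, 0⟩ : TriRing A B N) • m.1, by
    change (_ : TriRing A B N) • _ • m.1 = _
    rw [← mul_smul]
    congr 1
    ext <;> simp⟩
  one_smul m := Subtype.ext m.2
  mul_smul a b m := Subtype.ext (by
    change (_ : TriRing A B N) • m.1 = (_ : TriRing A B N) • (_ : TriRing A B N) • m.1
    rw [← mul_smul]
    congr 1
    ext <;> simp)
  smul_zero a := Subtype.ext (smul_zero (⟨a, 0, 0⟩ : TriRing A B N))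
  smul_add a m m' := Subtype.ext (smul_add (⟨a, 0, 0⟩ : TriRing A B N) m.1 m'.1)
  add_smul a b m := Subtype.ext (by
    change (_ : TriRing A B N) • m.1 = (_ : TriRing A B N) • m.1 + (_ : TriRing A B N) • m.1
    rw [← add_smul]
    congr 1
    ext <;> simp)
  zero_smul m := Subtype.ext (zero_smul (TriRing A B N) m.1)

instance : Module B (Lower A B N M) where
  smul b m := ⟨(⟨0, 0, b⟩ : TriRing A B N) • m.1, by
    change (_ : TriRing A B N) • _ • m.1 = _
    rw [← mul_smul]
    congr 1
    ext <;> simp⟩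
  one_smul m := Subtype.ext m.2
  mul_smul a b m := Subtype.ext (by
    change (_ : TriRing A B N) • m.1 = (_ : TriRing A B N) • (_ : TriRing A B N) • m.1
    rw [← mul_smul]
    congr 1
    ext <;> simp)
  smul_zero b := Subtype.ext (smul_zero (⟨0, 0, b⟩ : TriRing A B N))
  smul_add b m m' := Subtype.ext (smul_add (⟨0, 0, b⟩ : TriRing A B N) m.1 m'.1)
  add_smul a b m := Subtype.ext (by
    change (_ : TriRing A B N) • m.1 = (_ : TriRing A B N) • m.1 + (_ : TriRing A B N) • m.1
    rw [← add_smul]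
    congr 1
    ext <;> simp)
  zero_smul m := Subtype.ext (zero_smul (TriRing A B N) m.1)

variable (A B N) in
/-- The structure map `N ⊗_B e₂ M → e₁ M` of a `Γ`-module `M`. -/
def structureMap : BTensor A B N (Lower A B N M) →ₗ[A] Upper A B N M :=
  BTensor.lift
    (AddMonoidHom.mk' (fun n => AddMonoidHom.mk'
        (fun v => (⟨(⟨0, n, 0⟩ : TriRing A B N) • v.1, by
          change (_ : TriRing A B N) • _ • v.1 = _
          rw [← mul_smul]
          congr 1
          ext <;> simp⟩ : Upper A B N M))
        (fun v v' => Subtype.ext (smul_add (⟨0, n, 0⟩ : TriRing A B N) v.1 v'.1)))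
      (fun n n' => AddMonoidHom.ext fun v => Subtype.ext (by
        change (_ : TriRing A B N) • v.1 = (_ : TriRing A B N) • v.1 + (_ : TriRing A B N) • v.1
        rw [← add_smul]
        congr 1
        ext <;> simp)))
    (fun n b v => Subtype.ext (by
      change (_ : TriRing A B N) • v.1 = (_ : TriRing A B N) • (_ : TriRing A B N) • v.1
      rw [← mul_smul]
      congr 1
      ext <;> simp))
    (fun a n v => Subtype.ext (by
      change (_ : TriRing A B N) • v.1 = (_ : TriRing A B N) • (_ : TriRing A B N) • v.1
      rw [← mul_smul]
      congr 1
      ext <;> simp))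

variable (A B N) in
/-- The isomorphism between the triple `(e₁ M, e₂ M)` and `M`. -/
def ofModule : TriMod (structureMap A B N M) ≃ₗ[TriRing A B N] M where
  toFun m := m.1.1 + m.2.1
  map_add' m m' := add_add_add_comm m.1.1 m'.1.1 m.2.1 m'.2.1
  map_smul' r m := by
    change ((⟨r.a, 0, 0⟩ : TriRing A B N) • m.1.1 + (⟨0, r.n, 0⟩ : TriRing A B N) • m.2.1)
      + (⟨0, 0, r.b⟩ : TriRing A B N) • m.2.1 = r • (m.1.1 + m.2.1)
    have h₁ : (⟨r.a, 0, 0⟩ : TriRing A B N) = r * ⟨1, 0, 0⟩ := by ext <;> simp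
    have h₂ : (⟨0, r.n, 0⟩ : TriRing A B N) + ⟨0, 0, r.b⟩ = r * ⟨0, 0, 1⟩ := by ext <;> simp
    have e₁ : (⟨1, 0, 0⟩ : TriRing A B N) • m.1.1 = m.1.1 := m.1.2
    have e₂ : (⟨0, 0, 1⟩ : TriRing A B N) • m.2.1 = m.2.1 := m.2.2
    rw [add_assoc, ← add_smul, h₁, h₂, mul_smul, mul_smul, e₁, e₂, smul_add]
  invFun m := ((⟨(⟨1, 0, 0⟩ : TriRing A B N) • m, by
      change (_ : TriRing A B N) • _ • m = _
      rw [← mul_smul]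
      congr 1
      ext <;> simp⟩, ⟨(⟨0, 0, 1⟩ : TriRing A B N) • m, by
      change (_ : TriRing A B N) • _ • m = _
      rw [← mul_smul]
      congr 1
      ext <;> simp⟩) : Upper A B N M × Lower A B N M)
  left_inv m := by
    have e₁ : (⟨1, 0, 0⟩ : TriRing A B N) • m.1.1 = m.1.1 := m.1.2
    have e₂ : (⟨0, 0, 1⟩ : TriRing A B N) • m.2.1 = m.2.1 := m.2.2
    refine ext (Subtype.ext ?_) (Subtype.ext ?_)
    · change (⟨1, 0, 0⟩ : TriRing A B N) • (m.1.1 + m.2.1) = m.1.1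
      rw [smul_add, e₁, ← e₂, ← mul_smul]
      have : (⟨1, 0, 0⟩ : TriRing A B N) * ⟨0, 0, 1⟩ = 0 := by ext <;> simp
      rw [this, zero_smul, add_zero]
    · change (⟨0, 0, 1⟩ : TriRing A B N) • (m.1.1 + m.2.1) = m.2.1
      rw [smul_add, e₂, ← e₁, ← mul_smul]
      have : (⟨0, 0, 1⟩ : TriRing A B N) * ⟨1, 0, 0⟩ = 0 := by ext <;> simp
      rw [this, zero_smul, zero_add]
  right_inv m := by
    change (⟨1, 0, 0⟩ : TriRing A B N) • m + (⟨0, 0, 1⟩ : TriRing A B N) • m = m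
    rw [← add_smul]
    have : (⟨1, 0, 0⟩ : TriRing A B N) + ⟨0, 0, 1⟩ = 1 := by ext <;> simp
    rw [this, one_smul]

theorem exists_equiv :
    ∃ (U : ModuleCat.{u} A) (V : ModuleCat.{u} B) (f : BTensor A B N V →ₗ[A] U),
      Nonempty (M ≃ₗ[TriRing A B N] TriMod f) :=
  ⟨ModuleCat.of A (Upper A B N M), ModuleCat.of B (Lower A B N M), structureMap A B N M,
    ⟨(ofModule A B N M).symm⟩⟩

end Decomposition

end TriMod

/-! ### The modules `(X, 0) ⊕ (N ⊗_B Y, Y)` -/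

namespace TriSum

variable {A B N : Type u} [Ring A] [Ring B] [AddCommGroup N] [Module A N] [Module Bᵐᵒᵖ N]
variable {X Y X' Y' U V U' V' : Type u} [AddCommGroup X] [Module A X] [AddCommGroup Y] [Module B Y]
  [AddCommGroup X'] [Module A X'] [AddCommGroup Y'] [Module B Y']
  [AddCommGroup U] [Module A U] [AddCommGroup V] [Module B V]
  [AddCommGroup U'] [Module A U'] [AddCommGroup V'] [Module B V']
  {f : BTensor A B N V →ₗ[A] U} {f' : BTensor A B N V' →ₗ[A] U'}

theorem prodMap_compat (φ : X →ₗ[A] X') (ψ : Y →ₗ[B] Y') :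
    φ.prodMap (BTensor.map A B N ψ) ∘ₗ LinearMap.inr A X (BTensor A B N Y) =
      LinearMap.inr A X' (BTensor A B N Y') ∘ₗ BTensor.map A B N ψ := by
  ext <;> simp

variable [SMulCommClass A Bᵐᵒᵖ N]

instance : Subsingleton (BTensor A B N PUnit.{u + 1}) := BTensor.subsingleton

variable (A B N X Y) in
/-- The module `(X, 0) ⊕ (N ⊗_B Y, Y)` is the triple `(X ⊕ (N ⊗_B Y), Y)` with the inclusion of
the second summand as its structure map. -/
def equivTriMod :
    TriSum A B N X Y ≃ₗ[TriRing A B N] TriMod (LinearMap.inr A X (BTensor A B N Y)) :=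
  LinearEquiv.ofLinearMap
    (LinearMap.coprod
      (TriMod.map (LinearMap.inl A X (BTensor A B N Y)) (0 : PUnit.{u + 1} →ₗ[B] Y)
        (by rw [BTensor.map_zero, LinearMap.comp_zero, LinearMap.comp_zero]))
      (TriMod.map (LinearMap.inr A X (BTensor A B N Y)) LinearMap.id
        (by rw [BTensor.map_id])))
    (LinearMap.prod
      (TriMod.map (LinearMap.fst A X (BTensor A B N Y)) (0 : Y →ₗ[B] PUnit.{u + 1})
        (by rw [LinearMap.fst_comp_inr, LinearMap.zero_comp]))
      (TriMod.map (LinearMap.snd A X (BTensor A B N Y)) LinearMap.id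
        (by rw [LinearMap.snd_comp_inr, BTensor.map_id, LinearMap.comp_id])))
    (LinearMap.ext fun m => TriMod.ext (Prod.ext (add_zero m.1.1) (zero_add m.1.2))
      (zero_add m.2))
    (LinearMap.ext fun m => Prod.ext (TriMod.ext (add_zero m.1.1) rfl)
      (TriMod.ext (zero_add m.2.1) (zero_add m.2.2)))

/-- The map `(X, 0) ⊕ (N ⊗_B Y, Y) → (U, V, f)` given by maps `X → U` and `Y → V`. -/
def desc (f : BTensor A B N V →ₗ[A] U) (a : X →ₗ[A] U) (b : Y →ₗ[B] V) :
    TriSum A B N X Y →ₗ[TriRing A B N] TriMod f :=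
  LinearMap.coprod
    (TriMod.map a (0 : PUnit.{u + 1} →ₗ[B] V) (by rw [BTensor.map_zero]; simp))
    (TriMod.map (f ∘ₗ BTensor.map A B N b) b rfl)

theorem desc_apply_fst (a : X →ₗ[A] U) (b : Y →ₗ[B] V) (m : TriSum A B N X Y) :
    (desc f a b m).1 = a m.1.1 + f (BTensor.map A B N b m.2.1) := rfl

theorem desc_apply_snd (a : X →ₗ[A] U) (b : Y →ₗ[B] V) (m : TriSum A B N X Y) :
    (desc f a b m).2 = b m.2.2 := zero_add (b m.2.2)

theorem desc_inj {a a' : X →ₗ[A] U} {b b' : Y →ₗ[B] V} :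
    desc f a b = desc f a' b' ↔ a = a' ∧ b = b' := by
  refine ⟨fun H => ⟨LinearMap.ext fun x => ?_, LinearMap.ext fun y => ?_⟩, ?_⟩
  · have := congrArg Prod.fst (LinearMap.congr_fun H
      (((x, 0) : X × PUnit.{u + 1}), ((0, 0) : BTensor A B N Y × Y)))
    change (desc f a b _).1 = (desc f a' b' _).1 at this
    rw [desc_apply_fst, desc_apply_fst] at this
    simpa using this
  · have := congrArg Prod.snd (LinearMap.congr_fun H
      (((0, 0) : X × PUnit.{u + 1}), ((0, y) : BTensor A B N Y × Y)))
    change (desc f a b _).2 = (desc f a' b' _).2 at this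
    rwa [desc_apply_snd, desc_apply_snd] at this
  · rintro ⟨rfl, rfl⟩
    rfl

@[simp] theorem desc_zero : desc f (0 : X →ₗ[A] U) (0 : Y →ₗ[B] V) = 0 := by
  refine LinearMap.ext fun m => TriMod.ext ?_ ?_
  · rw [desc_apply_fst, BTensor.map_zero]
    exact (zero_add _).trans (LinearMap.map_zero f)
  · rw [desc_apply_snd]
    rfl

/-- The functor `(X, Y) ↦ (X, 0) ⊕ (N ⊗_B Y, Y)` is left adjoint to `(U, V, f) ↦ (U, V)`. -/
theorem exists_eq_desc (g : TriSum A B N X Y →ₗ[TriRing A B N] TriMod f) :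
    ∃ (a : X →ₗ[A] U) (b : Y →ₗ[B] V), g = desc f a b := by
  obtain ⟨a, z, h, hg⟩ := TriMod.exists_eq_map (g ∘ₗ LinearMap.inl _ _ _)
  obtain ⟨a', b, h', hg'⟩ := TriMod.exists_eq_map (g ∘ₗ LinearMap.inr _ _ _)
  obtain rfl : z = 0 := LinearMap.ext fun x => by
    rw [Subsingleton.elim x 0, LinearMap.map_zero, LinearMap.map_zero]
  rw [LinearMap.comp_id] at h'
  subst h'
  exact ⟨a, b, by rw [desc, ← hg, ← hg', LinearMap.coprod_comp_inl_inr]⟩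

theorem desc_comp_map (a : X' →ₗ[A] U) (b : Y' →ₗ[B] V) (φ : X →ₗ[A] X') (ψ : Y →ₗ[B] Y') :
    desc f a b ∘ₗ map A B N φ ψ = desc f (a ∘ₗ φ) (b ∘ₗ ψ) := by
  refine LinearMap.ext fun m => TriMod.ext ?_ rfl
  rw [desc_apply_fst, BTensor.map_comp]
  rfl

theorem map_comp_desc {a' : U →ₗ[A] U'} {b' : V →ₗ[B] V'}
    (h : a' ∘ₗ f = f' ∘ₗ BTensor.map A B N b') (a : X →ₗ[A] U) (b : Y →ₗ[B] V) :
    TriMod.map a' b' h ∘ₗ desc f a b = desc f' (a' ∘ₗ a) (b' ∘ₗ b) := by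
  refine LinearMap.ext fun m => TriMod.ext ?_ ?_
  · rw [LinearMap.comp_apply, TriMod.map_apply_fst, desc_apply_fst, desc_apply_fst,
      BTensor.map_comp, LinearMap.map_add]
    exact congrArg _ (LinearMap.congr_fun h _)
  · rw [LinearMap.comp_apply, TriMod.map_apply_snd, desc_apply_snd, desc_apply_snd]
    rfl

@[simp] theorem map_id :
    map A B N (LinearMap.id : X →ₗ[A] X) (LinearMap.id : Y →ₗ[B] Y) = LinearMap.id :=
  LinearMap.ext fun m => Prod.ext rfl
    (TriMod.ext (LinearMap.congr_fun (BTensor.map_id (A := A) (B := B) (N := N)) m.2.1) rfl)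

@[simp] theorem map_zero : map A B N (0 : X →ₗ[A] X') (0 : Y →ₗ[B] Y') = 0 :=
  LinearMap.ext fun m => Prod.ext rfl
    (TriMod.ext (LinearMap.congr_fun (BTensor.map_zero (A := A) (B := B) (N := N)) m.2.1) rfl)

theorem map_comp (φ' : X' →ₗ[A] U) (ψ' : Y' →ₗ[B] V) (φ : X →ₗ[A] X') (ψ : Y →ₗ[B] Y') :
    map A B N φ' ψ' ∘ₗ map A B N φ ψ = map A B N (φ' ∘ₗ φ) (ψ' ∘ₗ ψ) :=
  LinearMap.ext fun _ => Prod.ext rfl (TriMod.ext (BTensor.map_map _ _ _) rfl)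

theorem equivTriMod_comp_map (φ : X →ₗ[A] X') (ψ : Y →ₗ[B] Y') :
    (equivTriMod A B N X' Y').toLinearMap ∘ₗ map A B N φ ψ =
      TriMod.map (φ.prodMap (BTensor.map A B N ψ)) ψ (prodMap_compat φ ψ) ∘ₗ
        (equivTriMod A B N X Y).toLinearMap := by
  refine LinearMap.ext fun m => TriMod.ext (Prod.ext ?_ ?_) ?_
  · exact (LinearMap.map_add φ m.1.1 0 |>.trans (by rw [LinearMap.map_zero]; rfl)).symm
  · exact (LinearMap.map_add (BTensor.map A B N ψ) 0 m.2.1 |>.trans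
      (by rw [LinearMap.map_zero]; rfl)).symm
  · exact (LinearMap.map_add ψ 0 m.2.2 |>.trans (by rw [LinearMap.map_zero]; rfl)).symm

theorem desc_comp_equivTriMod_symm (a : X →ₗ[A] U) (b : Y →ₗ[B] V) :
    desc f a b ∘ₗ (equivTriMod A B N X Y).symm.toLinearMap =
      TriMod.map (a.coprod (f ∘ₗ BTensor.map A B N b)) b (by rw [LinearMap.coprod_inr]) :=
  LinearMap.ext fun m => TriMod.ext rfl (zero_add (b m.2))

/-- `(X, Y) ↦ (X, 0) ⊕ (N ⊗_B Y, Y)` commutes with direct sums. -/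
theorem exists_finsuppEquiv (I : Type u) :
    Nonempty ((I →₀ TriSum A B N X Y) ≃ₗ[TriRing A B N] TriSum A B N (I →₀ X) (I →₀ Y)) := by
  let F : (I →₀ TriSum A B N X Y) →ₗ[TriRing A B N] TriSum A B N (I →₀ X) (I →₀ Y) :=
    Finsupp.lsum ℕ fun i => map A B N (Finsupp.lsingle i) (Finsupp.lsingle i)
  have hF : ∀ i m, F (Finsupp.single i m) =
      map A B N (Finsupp.lsingle i) (Finsupp.lsingle i) m := fun i m => by simp [F]
  have hinv : ∀ j x, map A B N (Finsupp.lapply j) (Finsupp.lapply j) (F x) = x j := by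
    intro j x
    induction x using Finsupp.induction_linear with
    | zero => rw [LinearMap.map_zero, LinearMap.map_zero, Finsupp.zero_apply]
    | add x y hx hy => rw [LinearMap.map_add, LinearMap.map_add, hx, hy, Finsupp.add_apply]
    | single i m =>
      rw [hF, ← LinearMap.comp_apply, map_comp]
      classical
      by_cases hij : i = j
      · subst hij
        rw [Finsupp.single_eq_same, Finsupp.lapply_comp_lsingle_same,
          Finsupp.lapply_comp_lsingle_same, map_id, LinearMap.id_apply]
      · rw [Finsupp.single_eq_of_ne (Ne.symm hij), Finsupp.lapply_comp_lsingle_of_ne _ _ (Ne.symm hij),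
          Finsupp.lapply_comp_lsingle_of_ne _ _ (Ne.symm hij), map_zero, LinearMap.zero_apply]
  refine ⟨LinearEquiv.ofBijective F ⟨fun x y hxy => Finsupp.ext fun j => ?_, fun m => ?_⟩⟩
  · rw [← hinv, hxy, hinv]
  · let ι₁ := LinearMap.inl (TriRing A B N) (TriZ A B N (I →₀ X)) (TriT A B N (I →₀ Y))
    let ι₂ := LinearMap.inr (TriRing A B N) (TriZ A B N (I →₀ X)) (TriT A B N (I →₀ Y))
    have h1 : ∀ x, ι₁ (TriMod.inl 0 x) ∈ LinearMap.range F := fun x => by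
      induction x using Finsupp.induction_linear with
      | zero => exact Submodule.zero_mem _
      | add x y hx hy =>
        rw [TriMod.inl_add, LinearMap.map_add]
        exact Submodule.add_mem _ hx hy
      | single i x =>
        refine ⟨Finsupp.single i (TriMod.inl 0 x, 0), (hF _ _).trans (Prod.ext rfl ?_)⟩
        exact LinearMap.map_zero (TriT.map A B N (Finsupp.lsingle i))
    have h2 : ∀ y, ι₂ (TriMod.inr LinearMap.id y) ∈ LinearMap.range F := fun y => by
      induction y using Finsupp.induction_linear with
      | zero => exact Submodule.zero_mem _
      | add x y hx hy =>
        rw [TriMod.inr_add, LinearMap.map_add]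
        exact Submodule.add_mem _ hx hy
      | single i y =>
        refine ⟨Finsupp.single i (0, TriMod.inr LinearMap.id y), (hF _ _).trans
          (Prod.ext ?_ (TriMod.ext ?_ rfl))⟩
        · exact LinearMap.map_zero (TriZ.map A B N (Finsupp.lsingle i))
        · exact LinearMap.map_zero (BTensor.map A B N (Finsupp.lsingle i))
    have h3 : ∀ t, ι₂ (TriMod.inl LinearMap.id t) ∈ LinearMap.range F := fun t => by
      induction t using BTensor.induction with
      | tmul n y =>
        have h := Submodule.smul_mem _ (⟨0, n, 0⟩ : TriRing A B N) (h2 y)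
        rw [← LinearMap.map_smul, TriMod.smul_inr, zero_smul] at h
        convert h using 2
        exact (add_zero _).symm
      | add x y hx hy =>
        rw [TriMod.inl_add, LinearMap.map_add]
        exact Submodule.add_mem _ hx hy
    have hm : m = ι₁ (TriMod.inl 0 m.1.1) +
        (ι₂ (TriMod.inl LinearMap.id m.2.1) + ι₂ (TriMod.inr LinearMap.id m.2.2)) := by
      rw [← LinearMap.map_add, TriMod.inl_add_inr]
      exact Prod.ext (add_zero m.1).symm (zero_add m.2).symm
    rw [hm]
    exact Submodule.add_mem _ (h1 _) (Submodule.add_mem _ (h3 _) (h2 _))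

end TriSum

/-! ### Projective modules over the triangular matrix ring -/

namespace TriMod

variable {A B N : Type u} [Ring A] [Ring B] [AddCommGroup N] [Module A N] [Module Bᵐᵒᵖ N]
variable {U V U' V' U'' V'' : Type u} [AddCommGroup U] [Module A U] [AddCommGroup V] [Module B V]
  [AddCommGroup U'] [Module A U'] [AddCommGroup V'] [Module B V']
  [AddCommGroup U''] [Module A U''] [AddCommGroup V''] [Module B V'']
  {f : BTensor A B N V →ₗ[A] U} {f' : BTensor A B N V' →ₗ[A] U'}
  {f'' : BTensor A B N V'' →ₗ[A] U''}

/-- The map `coker f → coker f'` induced by a map of triples `(U, V, f) → (U', V', f')`. -/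
def cokerMap (a : U →ₗ[A] U') (b : V →ₗ[B] V') (h : a ∘ₗ f = f' ∘ₗ BTensor.map A B N b) :
    (U ⧸ LinearMap.range f) →ₗ[A] (U' ⧸ LinearMap.range f') :=
  Submodule.mapQ _ _ a (by
    rintro _ ⟨t, rfl⟩
    exact ⟨BTensor.map A B N b t, (LinearMap.congr_fun h t).symm⟩)

theorem cokerMap_mk (a : U →ₗ[A] U') (b : V →ₗ[B] V')
    (h : a ∘ₗ f = f' ∘ₗ BTensor.map A B N b) (x : U) :
    cokerMap a b h ((LinearMap.range f).mkQ x) = (LinearMap.range f').mkQ (a x) := rfl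

theorem cokerMap_surjective {a : U →ₗ[A] U'} {b : V →ₗ[B] V'}
    {h : a ∘ₗ f = f' ∘ₗ BTensor.map A B N b} (ha : Function.Surjective a) :
    Function.Surjective (cokerMap a b h) := fun c => by
  obtain ⟨x, rfl⟩ := Submodule.mkQ_surjective _ c
  obtain ⟨x, rfl⟩ := ha x
  exact ⟨(LinearMap.range f).mkQ x, rfl⟩

theorem cokerMap_exact {a : U →ₗ[A] U'} {b : V →ₗ[B] V'}
    {h : a ∘ₗ f = f' ∘ₗ BTensor.map A B N b} {a' : U' →ₗ[A] U''} {b' : V' →ₗ[B] V''}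
    {h' : a' ∘ₗ f' = f'' ∘ₗ BTensor.map A B N b'} (haa : Function.Exact a a')
    (hb' : Function.Surjective b') : Function.Exact (cokerMap a b h) (cokerMap a' b' h') := by
  refine LinearMap.exact_of_comp_of_mem_range ?_ fun c hc => ?_
  · refine LinearMap.ext fun c => ?_
    obtain ⟨x, rfl⟩ := Submodule.mkQ_surjective _ c
    rw [LinearMap.comp_apply, cokerMap_mk, cokerMap_mk, haa.apply_apply_eq_zero,
      LinearMap.map_zero, LinearMap.zero_apply]
  · obtain ⟨x, rfl⟩ := Submodule.mkQ_surjective _ c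
    rw [cokerMap_mk, Submodule.mkQ_apply, Submodule.Quotient.mk_eq_zero] at hc
    obtain ⟨t, ht⟩ := hc
    obtain ⟨t, rfl⟩ := BTensor.map_surjective hb' t
    have h0 : a' (x - f' t) = 0 := by
      have := LinearMap.congr_fun h' t
      simp only [LinearMap.comp_apply] at this
      rw [LinearMap.map_sub, this, ht, sub_self]
    obtain ⟨y, hy⟩ := (haa _).1 h0
    refine ⟨(LinearMap.range f).mkQ y, ?_⟩
    rw [cokerMap_mk, hy, LinearMap.map_sub, sub_eq_self, Submodule.mkQ_apply,
      Submodule.Quotient.mk_eq_zero]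
    exact ⟨t, rfl⟩

variable [SMulCommClass A Bᵐᵒᵖ N]

theorem cokerMap_injective {a : U →ₗ[A] U'} {b : V →ₗ[B] V'}
    {h : a ∘ₗ f = f' ∘ₗ BTensor.map A B N b} {a' : U' →ₗ[A] U''} {b' : V' →ₗ[B] V''}
    {h' : a' ∘ₗ f' = f'' ∘ₗ BTensor.map A B N b'} (hNB : Module.Projective Bᵐᵒᵖ N)
    (ha : Function.Injective a) (haa : Function.Exact a a') (hbb : Function.Exact b b')
    (hf'' : Function.Injective f'') : Function.Injective (cokerMap a b h) := by
  refine (injective_iff_map_eq_zero _).2 fun c hc => ?_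
  obtain ⟨x, rfl⟩ := Submodule.mkQ_surjective _ c
  rw [cokerMap_mk, Submodule.mkQ_apply, Submodule.Quotient.mk_eq_zero] at hc
  obtain ⟨t, ht⟩ := hc
  have h0 : BTensor.map A B N b' t = 0 := by
    apply hf''
    have := LinearMap.congr_fun h' t
    simp only [LinearMap.comp_apply] at this
    rw [← this, ht, haa.apply_apply_eq_zero, LinearMap.map_zero]
  obtain ⟨s, rfl⟩ := (BTensor.map_exact hNB hbb t).1 h0
  rw [Submodule.mkQ_apply, Submodule.Quotient.mk_eq_zero]
  exact ⟨s, ha ((LinearMap.congr_fun h s).trans ht)⟩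

theorem projective_snd (h : Module.Projective (TriRing A B N) (TriMod f)) :
    Module.Projective B V := by
  refine Module.Projective.of_lifting_property'' fun q hq => ?_
  let p : TriMod (0 : BTensor A B N (V →₀ B) →ₗ[A] PUnit.{u + 1}) →ₗ[TriRing A B N]
      TriMod (0 : BTensor A B N V →ₗ[A] PUnit.{u + 1}) :=
    map LinearMap.id q (by rw [LinearMap.comp_zero, LinearMap.zero_comp])
  have hp : Function.Surjective p := map_surjective_iff.2 ⟨Function.surjective_id, hq⟩
  obtain ⟨k, hk⟩ := Module.projective_lifting_property p
    (map (0 : U →ₗ[A] PUnit.{u + 1}) LinearMap.id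
      (by rw [LinearMap.zero_comp, LinearMap.zero_comp]) : TriMod f →ₗ[TriRing A B N] _) hp
  obtain ⟨a, b, hab, rfl⟩ := exists_eq_map k
  exact ⟨b, (map_comp_map_eq_iff.1 hk).2⟩

theorem projective_coker (h : Module.Projective (TriRing A B N) (TriMod f)) :
    Module.Projective A (U ⧸ LinearMap.range f) := by
  refine Module.Projective.of_lifting_property'' fun q hq => ?_
  have hp : Function.Surjective (TriZ.map A B N q) :=
    map_surjective_iff.2 ⟨hq, Function.surjective_id⟩
  obtain ⟨k, hk⟩ := Module.projective_lifting_property (TriZ.map A B N q)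
    (map (LinearMap.range f).mkQ (0 : V →ₗ[B] PUnit.{u + 1})
      (by rw [LinearMap.range_mkQ_comp, LinearMap.zero_comp])) hp
  obtain ⟨a, b, hab, rfl⟩ := exists_eq_map k
  have ha := (map_comp_map_eq_iff.1 hk).1
  rw [LinearMap.zero_comp] at hab
  refine ⟨(LinearMap.range f).liftQ a (LinearMap.range_le_ker_iff.2 hab), ?_⟩
  refine Submodule.linearMap_qext _ ?_
  rw [LinearMap.comp_assoc, Submodule.liftQ_mkQ, ha, LinearMap.id_comp]

theorem structure_injective_of_projective (h : Module.Projective (TriRing A B N) (TriMod f)) :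
    Function.Injective f := by
  let p : TriMod (LinearMap.inr A U (BTensor A B N V)) →ₗ[TriRing A B N] TriMod f :=
    map (LinearMap.id.coprod f) LinearMap.id (by
      rw [LinearMap.coprod_inr, BTensor.map_id, LinearMap.comp_id])
  have hp : Function.Surjective p :=
    map_surjective_iff.2 ⟨fun x => ⟨(x, 0), by simp⟩, Function.surjective_id⟩
  obtain ⟨k, hk⟩ := Module.projective_lifting_property p LinearMap.id hp
  obtain ⟨a, b, hab, rfl⟩ := exists_eq_map k
  have hk' : p ∘ₗ map a b hab = map LinearMap.id LinearMap.id
      (by rw [BTensor.map_id, LinearMap.comp_id, LinearMap.id_comp]) := hk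
  have hb : b = LinearMap.id := (map_comp_map_eq_iff.1 hk').2
  subst hb
  rw [BTensor.map_id, LinearMap.comp_id] at hab
  intro t t' htt
  have h1 := LinearMap.congr_fun hab t
  have h2 := LinearMap.congr_fun hab t'
  rw [LinearMap.comp_apply] at h1 h2
  rw [htt, h2] at h1
  exact (LinearMap.inr_injective h1).symm

end TriMod

namespace TriSum

variable {A B N : Type u} [Ring A] [Ring B] [AddCommGroup N] [Module A N] [Module Bᵐᵒᵖ N]
  [SMulCommClass A Bᵐᵒᵖ N]
variable {P E U V : Type u} [AddCommGroup P] [Module A P] [AddCommGroup E] [Module B E]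
  [AddCommGroup U] [Module A U] [AddCommGroup V] [Module B V] {f : BTensor A B N V →ₗ[A] U}

theorem projective (hP : Module.Projective A P) (hE : Module.Projective B E) :
    Module.Projective (TriRing A B N) (TriSum A B N P E) := by
  refine Module.Projective.of_lifting_property'' fun q hq => ?_
  obtain ⟨U, V, f, ⟨e⟩⟩ := TriMod.exists_equiv (A := A) (B := B) (N := N)
    (TriSum A B N P E →₀ TriRing A B N)
  let σ := equivTriMod A B N P E
  obtain ⟨a, b, h, hab⟩ := TriMod.exists_eq_map
    (σ.toLinearMap ∘ₗ q ∘ₗ e.symm.toLinearMap)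
  have hs : Function.Surjective (TriMod.map a b h) := by
    rw [← hab]
    exact σ.surjective.comp (hq.comp e.symm.surjective)
  obtain ⟨ha, hb⟩ := TriMod.map_surjective_iff.1 hs
  obtain ⟨a', b', hσ⟩ := exists_eq_desc σ.toLinearMap
  obtain ⟨a'', rfl⟩ := Module.projective_lifting_property a a' ha
  obtain ⟨b'', rfl⟩ := Module.projective_lifting_property b b' hb
  refine ⟨e.symm.toLinearMap ∘ₗ desc f a'' b'', ?_⟩
  have h1 : σ.toLinearMap ∘ₗ q ∘ₗ e.symm.toLinearMap ∘ₗ desc f a'' b'' = σ.toLinearMap := by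
    have := map_comp_desc h a'' b''
    rw [← hab, ← hσ] at this
    exact this
  exact LinearMap.ext fun m => σ.injective (LinearMap.congr_fun h1 m)

theorem projective_triZ (hP : Module.Projective A P) :
    Module.Projective (TriRing A B N) (TriZ A B N P) :=
  have := projective (N := N) hP (inferInstance : Module.Projective B PUnit.{u + 1})
  Module.Projective.of_split (LinearMap.inl _ _ (TriT A B N PUnit.{u + 1}))
    (LinearMap.fst _ _ _) (LinearMap.fst_comp_inl ..)

theorem projective_triT (hE : Module.Projective B E) :
    Module.Projective (TriRing A B N) (TriT A B N E) :=
  have := projective (N := N) (inferInstance : Module.Projective A PUnit.{u + 1}) hE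
  Module.Projective.of_split (LinearMap.inr _ (TriZ A B N PUnit.{u + 1}) _)
    (LinearMap.snd _ _ _) (LinearMap.snd_comp_inr ..)

end TriSum

/-! ### Gorenstein-projective modules over the triangular matrix ring -/

section GorensteinProjective

variable {A B N : Type u} [Ring A] [Ring B] [AddCommGroup N] [Module A N] [Module Bᵐᵒᵖ N]
  [SMulCommClass A Bᵐᵒᵖ N]
variable {P E U V : Type u} [AddCommGroup P] [Module A P] [AddCommGroup E] [Module B E]
  [AddCommGroup U] [Module A U] [AddCommGroup V] [Module B V] {f : BTensor A B N V →ₗ[A] U}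

/-- The functor `E ↦ (N ⊗_B E, E)` is exact, preserves projectives, and is left adjoint to a functor
preserving projectives, so it sends complete resolutions to complete resolutions. -/
theorem IsGorensteinProjective.triT (hNB : Module.Projective Bᵐᵒᵖ N)
    (hE : IsGorensteinProjective B E) :
    IsGorensteinProjective (TriRing A B N) (TriT A B N E) := by
  obtain ⟨Q, d, hQ, hd, hHom, ι, hι, hιd⟩ := isGorensteinProjective_iff.1 hE
  refine isGorensteinProjective_iff.2 ⟨fun i => ModuleCat.of _ (TriT A B N (Q i)),
    fun i => TriT.map A B N (d i), fun i => TriSum.projective_triT (hQ i),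
    fun i => TriMod.map_exact_iff.2 ⟨BTensor.map_exact hNB (hd i), hd i⟩,
    fun M hM i g hg => ?_, TriT.map A B N ι,
    TriMod.map_injective_iff.2 ⟨BTensor.map_injective hNB hι, hι⟩,
    TriMod.map_exact_iff.2 ⟨BTensor.map_exact hNB hιd, hιd⟩⟩
  obtain ⟨U, V, f, ⟨e⟩⟩ := TriMod.exists_equiv (A := A) (B := B) (N := N) M
  obtain ⟨a, b, h, hab⟩ := TriMod.exists_eq_map (f := LinearMap.id) (f' := f) (e.toLinearMap ∘ₗ g)
  have hV := TriMod.projective_snd (Module.Projective.of_equiv e)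
  rw [LinearMap.comp_id] at h
  subst h
  have hb : b ∘ₗ d i = 0 := by
    have h1 : TriMod.map (f ∘ₗ BTensor.map A B N b) b rfl ∘ₗ TriT.map A B N (d i) = 0 := by
      rw [← hab, LinearMap.comp_assoc, hg, LinearMap.comp_zero]
    exact LinearMap.ext fun y => congrArg Prod.snd
      (LinearMap.congr_fun h1 (TriMod.inr LinearMap.id y))
  obtain ⟨c, hc⟩ := hHom V hV i b hb
  refine ⟨e.symm.toLinearMap ∘ₗ TriMod.map (f ∘ₗ BTensor.map A B N c) c rfl, ?_⟩
  have h2 : TriMod.map (f ∘ₗ BTensor.map A B N c) c rfl ∘ₗ TriT.map A B N (d (i + 1)) =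
      e.toLinearMap ∘ₗ g := by
    rw [hab]
    refine TriMod.map_comp_map_eq_iff.2 ⟨?_, hc⟩
    rw [LinearMap.comp_assoc, ← BTensor.map_comp, hc]
  rw [LinearMap.comp_assoc, h2]
  ext m
  simp

/-- A complete resolution of a triple may be taken to consist of triples. -/
theorem IsGorensteinProjective.exists_triMod_resolution
    (hf : IsGorensteinProjective (TriRing A B N) (TriMod f)) :
    ∃ (W : ℤ → ModuleCat.{u} A) (Q : ℤ → ModuleCat.{u} B)
      (g : ∀ i, BTensor A B N (Q i) →ₗ[A] W i) (a : ∀ i, W i →ₗ[A] W (i + 1))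
      (b : ∀ i, Q i →ₗ[B] Q (i + 1)) (h : ∀ i, a i ∘ₗ g i = g (i + 1) ∘ₗ BTensor.map A B N (b i)),
      (∀ i, Module.Projective (TriRing A B N) (TriMod (g i))) ∧
      (∀ i, Function.Exact (TriMod.map (a i) (b i) (h i))
        (TriMod.map (a (i + 1)) (b (i + 1)) (h (i + 1)))) ∧
      (∀ M : ModuleCat.{u} (TriRing A B N), Module.Projective (TriRing A B N) M → ∀ (i : ℤ)
        (k : TriMod (g (i + 1)) →ₗ[TriRing A B N] M), k ∘ₗ TriMod.map (a i) (b i) (h i) = 0 →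
        ∃ l : TriMod (g (i + 1 + 1)) →ₗ[TriRing A B N] M,
          l ∘ₗ TriMod.map (a (i + 1)) (b (i + 1)) (h (i + 1)) = k) ∧
      ∃ (α : U →ₗ[A] W 0) (β : V →ₗ[B] Q 0) (hαβ : α ∘ₗ f = g 0 ∘ₗ BTensor.map A B N β),
        Function.Injective (TriMod.map α β hαβ) ∧
        Function.Exact (TriMod.map α β hαβ) (TriMod.map (a 0) (b 0) (h 0)) := by
  obtain ⟨P, d, hP, hd, hHom, ι, hι, hιd⟩ := isGorensteinProjective_iff.1 hf
  choose W Q g e using fun i => TriMod.exists_equiv (A := A) (B := B) (N := N) (P i)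
  replace e := fun i => (e i).some
  choose a b h hab using fun i => TriMod.exists_eq_map
    ((e (i + 1)).toLinearMap ∘ₗ d i ∘ₗ (e i).symm.toLinearMap)
  obtain ⟨α, β, hαβ, hι'⟩ := TriMod.exists_eq_map ((e 0).toLinearMap ∘ₗ ι)
  have hde : ∀ i, TriMod.map (a i) (b i) (h i) ∘ₗ (e i).toLinearMap =
      (e (i + 1)).toLinearMap ∘ₗ d i := fun i => by
    rw [← hab]
    ext x
    simp
  refine ⟨W, Q, g, a, b, h, fun i => Module.Projective.of_equiv (e i), fun i =>
    (Function.Exact.iff_of_ladder_linearEquiv (hde i) (hde (i + 1))).2 (hd i),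
    fun M hM i k hk => ?_, α, β, hαβ, ?_, ?_⟩
  · obtain ⟨l, hl⟩ := hHom M hM i (k ∘ₗ (e (i + 1)).toLinearMap) (by
      rw [LinearMap.comp_assoc, ← hde, ← LinearMap.comp_assoc, hk, LinearMap.zero_comp])
    refine ⟨l ∘ₗ (e (i + 1 + 1)).symm.toLinearMap, ?_⟩
    rw [← hab]
    refine LinearMap.ext fun x => ?_
    have := LinearMap.congr_fun hl ((e (i + 1)).symm x)
    simpa using this
  · rw [← hι']
    exact (e 0).injective.comp hι
  · rw [← hι']
    exact (Function.Exact.iff_of_ladder_linearEquiv (e₁ := LinearEquiv.refl _ _) (by ext; simp)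
      (hde 0)).2 hιd

/-- The lower component of a complete resolution of `Γ`-modules is a complete resolution of
`B`-modules. For the acyclicity of `Hom(-, Q)` with `Q` projective one uses the exact sequence
`0 → (N ⊗_B Q, 0) → (N ⊗_B Q, Q) → (0, Q) → 0`, whose first two terms are projective. -/
theorem IsGorensteinProjective.snd (hAN : Module.Projective A N)
    (hf : IsGorensteinProjective (TriRing A B N) (TriMod f)) : IsGorensteinProjective B V := by
  obtain ⟨W, Q, g, a, b, h, hP, hd, hHom, α, β, hαβ, hι, hιd⟩ := hf.exists_triMod_resolution
  refine isGorensteinProjective_iff.2 ⟨Q, b, fun i => TriMod.projective_snd (hP i),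
    fun i => (TriMod.map_exact_iff.1 (hd i)).2, fun M hM i q hq => ?_, β,
    (TriMod.map_injective_iff.1 hι).2, (TriMod.map_exact_iff.1 hιd).2⟩
  obtain ⟨j, rfl⟩ : ∃ j, i = j + 1 := ⟨i - 1, by ring⟩
  have hT : Module.Projective (TriRing A B N) (TriT A B N M) := TriSum.projective_triT hM
  have hZ : Module.Projective (TriRing A B N) (TriZ A B N (BTensor A B N M)) :=
    TriSum.projective_triZ (BTensor.projective hAN hM)
  have hPj := hP (j + 1 + 1)
  -- Lift `q` to a map `(l, q)` into `(N ⊗_B M, M)`.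
  let s : TriT A B N M →ₗ[TriRing A B N] TriMod (0 : BTensor A B N M →ₗ[A] PUnit.{u + 1}) :=
    TriMod.map 0 LinearMap.id (by rw [LinearMap.zero_comp, LinearMap.zero_comp])
  have hs : Function.Surjective s :=
    TriMod.map_surjective_iff.2 ⟨fun _ => ⟨0, rfl⟩, Function.surjective_id⟩
  obtain ⟨k, hk⟩ := Module.projective_lifting_property s
    (TriMod.map (f := g (j + 1 + 1)) 0 q (by rw [LinearMap.zero_comp, LinearMap.zero_comp])) hs
  obtain ⟨l, q', hl, rfl⟩ := TriMod.exists_eq_map k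
  obtain rfl : q' = q := (TriMod.map_comp_map_eq_iff.1 hk).2
  rw [LinearMap.id_comp] at hl
  have haa : a (j + 1) ∘ₗ a j = 0 := (TriMod.map_exact_iff.1 (hd j)).1.linearMap_comp_eq_zero
  -- The composite with the differential lands in `(N ⊗_B M, 0)` and is a coboundary there.
  have hx : (l ∘ₗ a (j + 1)) ∘ₗ g (j + 1) = 0 := by
    rw [LinearMap.comp_assoc, h, ← LinearMap.comp_assoc, hl, ← BTensor.map_comp, hq,
      BTensor.map_zero]
  let x : TriMod (g (j + 1)) →ₗ[TriRing A B N] TriZ A B N (BTensor A B N M) :=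
    TriMod.map (l ∘ₗ a (j + 1)) 0 (by rw [hx, LinearMap.zero_comp])
  have hx0 : x ∘ₗ TriMod.map (a j) (b j) (h j) = 0 := by
    refine LinearMap.ext fun m => TriMod.ext (?_ : l (a (j + 1) (a j m.1)) = 0) rfl
    have := LinearMap.congr_fun haa m.1
    rw [LinearMap.comp_apply, LinearMap.zero_apply] at this
    rw [this, LinearMap.map_zero]
  obtain ⟨y, hy⟩ := hHom (ModuleCat.of _ (TriZ A B N (BTensor A B N M))) hZ j x hx0
  obtain ⟨y₁, y₂, hy₁₂, rfl⟩ := TriMod.exists_eq_map (f := g (j + 1 + 1))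
    (f' := (0 : BTensor A B N PUnit.{u + 1} →ₗ[A] BTensor A B N M)) y
  have hya := (TriMod.map_comp_map_eq_iff.1 hy).1
  rw [LinearMap.zero_comp] at hy₁₂
  -- Subtracting it yields a lift of `q` that is a cocycle.
  let l' : TriMod (g (j + 1 + 1)) →ₗ[TriRing A B N] TriT A B N M :=
    TriMod.map (l - y₁) q' (by rw [LinearMap.sub_comp, hl, hy₁₂, sub_zero, LinearMap.id_comp])
  have hl' : l' ∘ₗ TriMod.map (a (j + 1)) (b (j + 1)) (h (j + 1)) = 0 := by
    refine LinearMap.ext fun m => TriMod.ext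
      (?_ : l (a (j + 1) m.1) - y₁ (a (j + 1) m.1) = 0) (LinearMap.congr_fun hq m.2)
    have := LinearMap.congr_fun hya m.1
    rw [LinearMap.comp_apply, LinearMap.comp_apply] at this
    rw [this, sub_self]
  obtain ⟨z, hz⟩ := hHom (ModuleCat.of _ (TriT A B N M)) hT (j + 1) l' hl'
  obtain ⟨z₁, z₂, hz₁₂, rfl⟩ := TriMod.exists_eq_map (f' := LinearMap.id) z
  exact ⟨z₂, (TriMod.map_comp_map_eq_iff.1 hz).2⟩

/-- A Gorenstein-projective triple `(U, V, f)` has a coresolution whose first term is a projective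
triple and whose cokernel is a Gorenstein-projective triple. -/
theorem IsGorensteinProjective.exists_triMod_coresolution
    (hf : IsGorensteinProjective (TriRing A B N) (TriMod f)) :
    ∃ (U₀ U₁ : ModuleCat.{u} A) (V₀ V₁ : ModuleCat.{u} B) (f₀ : BTensor A B N V₀ →ₗ[A] U₀)
      (f₁ : BTensor A B N V₁ →ₗ[A] U₁) (a : U →ₗ[A] U₀) (b : V →ₗ[B] V₀)
      (_ : a ∘ₗ f = f₀ ∘ₗ BTensor.map A B N b) (a' : U₀ →ₗ[A] U₁) (b' : V₀ →ₗ[B] V₁)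
      (_ : a' ∘ₗ f₀ = f₁ ∘ₗ BTensor.map A B N b'),
      Module.Projective (TriRing A B N) (TriMod f₀) ∧
      IsGorensteinProjective (TriRing A B N) (TriMod f₁) ∧
      (Function.Injective a ∧ Function.Injective b) ∧
      (Function.Exact a a' ∧ Function.Exact b b') ∧
      (Function.Surjective a' ∧ Function.Surjective b') := by
  obtain ⟨P, M, ι, p, hP, hM, hι, hιp, hp⟩ := hf.exists_coresolution
  obtain ⟨U₀, V₀, f₀, ⟨e₀⟩⟩ := TriMod.exists_equiv (A := A) (B := B) (N := N) P
  obtain ⟨U₁, V₁, f₁, ⟨e₁⟩⟩ := TriMod.exists_equiv (A := A) (B := B) (N := N) M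
  obtain ⟨a, b, h, hab⟩ := TriMod.exists_eq_map (e₀.toLinearMap ∘ₗ ι)
  obtain ⟨a', b', h', hab'⟩ := TriMod.exists_eq_map
    (e₁.toLinearMap ∘ₗ p ∘ₗ e₀.symm.toLinearMap)
  refine ⟨U₀, U₁, V₀, V₁, f₀, f₁, a, b, h, a', b', h', Module.Projective.of_equiv e₀,
    hM.of_equiv e₁, (TriMod.map_injective_iff (h := h)).1 ?_,
    (TriMod.map_exact_iff (h := h) (h' := h')).1 ?_,
    (TriMod.map_surjective_iff (h := h')).1 ?_⟩
  · rw [← hab]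
    exact e₀.injective.comp hι
  · rw [← hab, ← hab']
    refine (Function.Exact.iff_of_ladder_linearEquiv (e₁ := LinearEquiv.refl _ _) (e₂ := e₀)
      (e₃ := e₁) (by ext; simp) (by ext; simp)).2 hιp
  · rw [← hab']
    exact e₁.surjective.comp (hp.comp e₀.symm.surjective)

theorem IsGorensteinProjective.structure_injective (hNB : Module.Projective Bᵐᵒᵖ N)
    (hf : IsGorensteinProjective (TriRing A B N) (TriMod f)) : Function.Injective f := by
  obtain ⟨U₀, U₁, V₀, V₁, f₀, f₁, a, b, h, a', b', h', hP, -, ⟨-, hb⟩, -, -⟩ :=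
    hf.exists_triMod_coresolution
  have h1 : Function.Injective (a ∘ₗ f) := by
    rw [h]
    exact (TriMod.structure_injective_of_projective hP).comp (BTensor.map_injective hNB hb)
  exact Function.Injective.of_comp h1

/-- The cokernels of the structure maps of Gorenstein-projective triples are coresolved by
projective `A`-modules, so they are projective when `A` has finite global dimension. -/
theorem IsGorensteinProjective.projective_coker (hA : HasFiniteGlobalDimension A)
    (hNB : Module.Projective Bᵐᵒᵖ N)
    (hf : IsGorensteinProjective (TriRing A B N) (TriMod f)) :
    Module.Projective A (U ⧸ LinearMap.range f) := by
  refine hA.projective_of_coresolution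
    (fun M => ∃ (U : ModuleCat.{u} A) (V : ModuleCat.{u} B) (f : BTensor A B N V →ₗ[A] U),
      IsGorensteinProjective (TriRing A B N) (TriMod f) ∧
      Nonempty (M ≃ₗ[A] (U ⧸ LinearMap.range f))) ?_ (ModuleCat.of A (U ⧸ LinearMap.range f))
    ⟨ModuleCat.of A U, ModuleCat.of B V, f, hf, ⟨LinearEquiv.refl _ _⟩⟩
  rintro M ⟨U, V, f, hf, ⟨e⟩⟩
  obtain ⟨U₀, U₁, V₀, V₁, f₀, f₁, a, b, h, a', b', h', hP, hf₁, ⟨ha, hb⟩, ⟨haa, hbb⟩, ha', hb'⟩ :=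
    hf.exists_triMod_coresolution
  have hex : Function.Exact (TriMod.cokerMap a b h) (TriMod.cokerMap a' b' h') :=
    TriMod.cokerMap_exact haa hb'
  refine ⟨ModuleCat.of A (U₀ ⧸ LinearMap.range f₀), ModuleCat.of A (U₁ ⧸ LinearMap.range f₁),
    TriMod.cokerMap a b h ∘ₗ e.toLinearMap, TriMod.cokerMap a' b' h', TriMod.projective_coker hP,
    ⟨U₁, V₁, f₁, hf₁, ⟨LinearEquiv.refl _ _⟩⟩, ?_, ?_, TriMod.cokerMap_surjective ha'⟩
  · exact (TriMod.cokerMap_injective (h := h) (h' := h') hNB ha haa hbb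
      (hf₁.structure_injective hNB)).comp e.injective
  · intro c
    rw [hex c, LinearMap.coe_comp, LinearEquiv.coe_coe, e.surjective.range_comp]

/-- Over a triangular matrix ring with `A` of finite global dimension, the Gorenstein-projective
modules are the modules `(P, 0) ⊕ (N ⊗_B E, E)` with `P` projective and `E` Gorenstein-projective:
the structure map of a Gorenstein-projective triple is injective with projective cokernel. -/
theorem IsGorensteinProjective.exists_equiv_triSum (hA : HasFiniteGlobalDimension A)
    (hAN : Module.Projective A N) (hNB : Module.Projective Bᵐᵒᵖ N)
    {M : Type u} [AddCommGroup M] [Module (TriRing A B N) M]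
    (hM : IsGorensteinProjective (TriRing A B N) M) :
    ∃ (P : ModuleCat.{u} A) (E : ModuleCat.{u} B), Module.Projective A P ∧
      IsGorensteinProjective B E ∧ Nonempty (M ≃ₗ[TriRing A B N] TriSum A B N P E) := by
  obtain ⟨U, V, f, ⟨e⟩⟩ := TriMod.exists_equiv (A := A) (B := B) (N := N) M
  have hf := hM.of_equiv e
  have hC := hf.projective_coker hA hNB
  obtain ⟨s, hs⟩ := Module.projective_lifting_property (LinearMap.range f).mkQ LinearMap.id
    (Submodule.mkQ_surjective _)
  have hs' : ∀ c, (LinearMap.range f).mkQ (s c) = c := LinearMap.congr_fun hs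
  refine ⟨ModuleCat.of A (U ⧸ LinearMap.range f), V, hC, hf.snd hAN,
    ⟨e.trans (LinearEquiv.ofBijective (TriSum.desc f s LinearMap.id) ⟨?_, fun m => ?_⟩).symm⟩⟩
  · refine (injective_iff_map_eq_zero _).2 fun m hm => ?_
    have h1 : s m.1.1 + f m.2.1 = 0 := by
      have := congrArg Prod.fst hm
      change (TriSum.desc f s LinearMap.id m).1 = 0 at this
      rwa [TriSum.desc_apply_fst, BTensor.map_id] at this
    have h2 : m.2.2 = 0 := by
      have := congrArg Prod.snd hm
      change (TriSum.desc f s LinearMap.id m).2 = 0 at this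
      rwa [TriSum.desc_apply_snd] at this
    have h3 : m.1.1 = 0 := by
      rw [← hs' m.1.1, eq_neg_of_add_eq_zero_left h1, LinearMap.map_neg, neg_eq_zero,
        Submodule.mkQ_apply, Submodule.Quotient.mk_eq_zero]
      exact ⟨_, rfl⟩
    have h4 : m.2.1 = 0 := by
      rw [h3, LinearMap.map_zero, zero_add] at h1
      exact hf.structure_injective hNB (h1.trans (LinearMap.map_zero f).symm)
    exact Prod.ext (TriMod.ext h3 rfl) (TriMod.ext h4 h2)
  · have h1 : m.1 - s ((LinearMap.range f).mkQ m.1) ∈ LinearMap.range f := by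
      rw [← Submodule.Quotient.mk_eq_zero, ← Submodule.mkQ_apply, LinearMap.map_sub, hs', sub_self]
    obtain ⟨t, ht⟩ := h1
    refine ⟨(TriMod.inl 0 ((LinearMap.range f).mkQ m.1), ((t, m.2) : BTensor A B N V × V)),
      TriMod.ext ?_ ?_⟩
    · rw [TriSum.desc_apply_fst, BTensor.map_id]
      exact (congrArg (s ((LinearMap.range f).mkQ m.1) + ·) ht).trans (add_sub_cancel _ _)
    · rw [TriSum.desc_apply_snd]
      rfl

theorem isGorensteinProjective_triSum (hNB : Module.Projective Bᵐᵒᵖ N)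
    (hP : Module.Projective A P) (hE : IsGorensteinProjective B E) :
    IsGorensteinProjective (TriRing A B N) (TriSum A B N P E) :=
  (isGorensteinProjective_of_projective (TriSum.projective_triZ hP)).prod (hE.triT hNB)

theorem isGorensteinProjective_triSum_iff (hA : HasFiniteGlobalDimension A)
    (hAN : Module.Projective A N) (hNB : Module.Projective Bᵐᵒᵖ N) :
    IsGorensteinProjective (TriRing A B N) (TriSum A B N P E) ↔
      Module.Projective A P ∧ IsGorensteinProjective B E := by
  refine ⟨fun h => ?_, fun h => isGorensteinProjective_triSum hNB h.1 h.2⟩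
  have h1 := h.of_equiv (TriSum.equivTriMod A B N P E)
  have h2 := h1.projective_coker hA hNB
  refine ⟨Module.Projective.of_split
    ((LinearMap.range (LinearMap.inr A P (BTensor A B N E))).mkQ ∘ₗ LinearMap.inl A P _)
    ((LinearMap.range (LinearMap.inr A P (BTensor A B N E))).liftQ (LinearMap.fst A P _)
      (LinearMap.range_le_ker_iff.2 (LinearMap.fst_comp_inr ..))) rfl, h1.snd hAN⟩

end GorensteinProjective

/-! ### Relative exactness and generation over the triangular matrix ring -/

section RelativeTri

variable {A B N : Type u} [Ring A] [Ring B] [AddCommGroup N] [Module A N] [Module Bᵐᵒᵖ N]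

theorem traceSubmodule_bTensor_eq_top {X Y Y' : Type u} [AddCommGroup X] [Module A X]
    [AddCommGroup Y] [Module B Y] [AddCommGroup Y'] [Module B Y']
    (h : traceSubmodule A X (BTensor A B N Y) = ⊤) (h' : traceSubmodule B Y Y' = ⊤) :
    traceSubmodule A X (BTensor A B N Y') = ⊤ := by
  obtain ⟨I, p, hp⟩ := traceSubmodule_eq_top_iff.1 h'
  refine top_le_iff.1 fun t _ => ?_
  induction t using BTensor.induction with
  | tmul n y =>
    obtain ⟨z, rfl⟩ := hp y
    induction z using Finsupp.induction_linear with
    | zero => rw [LinearMap.map_zero, BTensor.tmul_zero]; exact Submodule.zero_mem _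
    | add z z' hz hz' =>
      rw [LinearMap.map_add, BTensor.tmul_add]
      exact Submodule.add_mem _ (hz trivial) (hz' trivial)
    | single i y =>
      exact map_mem_traceSubmodule h (BTensor.map A B N (p ∘ₗ Finsupp.lsingle i))
        (BTensor.tmul A B n y)
  | add s t hs ht => exact Submodule.add_mem _ (hs trivial) (ht trivial)

variable [SMulCommClass A Bᵐᵒᵖ N]
variable {X Y X' Y' X'' Y'' U V U' V' U'' V'' : Type u}
  [AddCommGroup X] [Module A X] [AddCommGroup Y] [Module B Y]
  [AddCommGroup X'] [Module A X'] [AddCommGroup Y'] [Module B Y']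
  [AddCommGroup X''] [Module A X''] [AddCommGroup Y''] [Module B Y'']
  [AddCommGroup U] [Module A U] [AddCommGroup V] [Module B V]
  [AddCommGroup U'] [Module A U'] [AddCommGroup V'] [Module B V']
  [AddCommGroup U''] [Module A U''] [AddCommGroup V''] [Module B V'']
  {f : BTensor A B N V →ₗ[A] U} {f' : BTensor A B N V' →ₗ[A] U'}
  {f'' : BTensor A B N V'' →ₗ[A] U''}

/-- Testing against `(P, 0)` and `(N ⊗_B E, E)` shows that `G`-epimorphisms of triples are detected
componentwise; on the upper component they are just the epimorphisms. -/
theorem TriMod.isGEpi_map_iff (hA : HasFiniteGlobalDimension A) (hAN : Module.Projective A N)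
    (hNB : Module.Projective Bᵐᵒᵖ N) {a : U →ₗ[A] U'} {b : V →ₗ[B] V'}
    {h : a ∘ₗ f = f' ∘ₗ BTensor.map A B N b} :
    IsGEpi (TriMod.map a b h) ↔ Function.Surjective a ∧ IsGEpi b := by
  constructor
  · intro H
    have hs := TriMod.map_surjective_iff.1 H.1
    refine ⟨hs.1, hs.2, fun E hE k => ?_⟩
    obtain ⟨l, hl⟩ := H.2 (ModuleCat.of _ (TriT A B N E)) (hE.triT hNB)
      (TriMod.map (f' ∘ₗ BTensor.map A B N k) k rfl)
    obtain ⟨a', b', h', rfl⟩ := TriMod.exists_eq_map (f := LinearMap.id) l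
    exact ⟨b', (TriMod.map_comp_map_eq_iff.1 hl).2⟩
  · rintro ⟨ha, hb⟩
    refine ⟨TriMod.map_surjective_iff.2 ⟨ha, hb.1⟩, fun G hG k => ?_⟩
    obtain ⟨P, E, hP, hE, ⟨e⟩⟩ := hG.exists_equiv_triSum hA hAN hNB
    obtain ⟨a', b', hk⟩ := TriSum.exists_eq_desc (k ∘ₗ e.symm.toLinearMap)
    obtain ⟨a'', rfl⟩ := Module.projective_lifting_property a a' ha
    obtain ⟨b'', rfl⟩ := hb.2 E hE b'
    refine ⟨TriSum.desc f a'' b'' ∘ₗ e.toLinearMap, ?_⟩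
    rw [← LinearMap.comp_assoc, TriSum.map_comp_desc, ← hk]
    ext x
    simp

theorem TriMod.isGExact_map_iff (hA : HasFiniteGlobalDimension A) (hAN : Module.Projective A N)
    (hNB : Module.Projective Bᵐᵒᵖ N) {a : U →ₗ[A] U'} {b : V →ₗ[B] V'}
    {h : a ∘ₗ f = f' ∘ₗ BTensor.map A B N b} {a' : U' →ₗ[A] U''} {b' : V' →ₗ[B] V''}
    {h' : a' ∘ₗ f' = f'' ∘ₗ BTensor.map A B N b'} :
    IsGExact (TriMod.map a b h) (TriMod.map a' b' h') ↔
      (Function.Exact a a' ∧ Function.Surjective a') ∧ IsGExact b b' := by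
  constructor
  · rintro ⟨H₁, H₂, H₃⟩
    have hex := TriMod.map_exact_iff.1 H₁
    have hs := (TriMod.isGEpi_map_iff hA hAN hNB).1 H₃
    refine ⟨⟨hex.1, hs.1⟩, hex.2, fun E hE k hk => ?_, hs.2⟩
    obtain ⟨l, hl⟩ := H₂ (ModuleCat.of _ (TriT A B N E)) (hE.triT hNB)
      (TriMod.map (f' ∘ₗ BTensor.map A B N k) k rfl) (by
        refine LinearMap.ext fun m => TriMod.ext ?_ (LinearMap.congr_fun hk m.2)
        have h0 : (a' ∘ₗ f') ∘ₗ BTensor.map A B N k = 0 := by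
          rw [h', LinearMap.comp_assoc, ← BTensor.map_comp, hk, BTensor.map_zero,
            LinearMap.comp_zero]
        exact LinearMap.congr_fun h0 m.1)
    obtain ⟨c, d, h'', rfl⟩ := TriMod.exists_eq_map (f := LinearMap.id) l
    exact ⟨d, (TriMod.map_comp_map_eq_iff.1 hl).2⟩
  · rintro ⟨⟨hex, hs⟩, H₁, H₂, H₃⟩
    refine ⟨TriMod.map_exact_iff.2 ⟨hex, H₁⟩, fun G hG k hk => ?_,
      (TriMod.isGEpi_map_iff hA hAN hNB).2 ⟨hs, H₃⟩⟩
    obtain ⟨P, E, hP, hE, ⟨e⟩⟩ := hG.exists_equiv_triSum hA hAN hNB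
    obtain ⟨c, d, hcd⟩ := TriSum.exists_eq_desc (k ∘ₗ e.symm.toLinearMap)
    have h0 : TriSum.desc f'' (a' ∘ₗ c) (b' ∘ₗ d) = TriSum.desc f'' 0 0 := by
      rw [← TriSum.map_comp_desc h', ← hcd, ← LinearMap.comp_assoc, hk, LinearMap.zero_comp,
        TriSum.desc_zero]
    obtain ⟨hc, hd⟩ := TriSum.desc_inj.1 h0
    obtain ⟨c', rfl⟩ := hex.exists_lift_of_projective c hc
    obtain ⟨d', rfl⟩ := H₂ E hE d hd
    refine ⟨TriSum.desc f c' d' ∘ₗ e.toLinearMap, ?_⟩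
    rw [← LinearMap.comp_assoc, TriSum.map_comp_desc, ← hcd]
    ext x
    simp

namespace TriSum

theorem isGEpi_desc_iff (hA : HasFiniteGlobalDimension A) (hAN : Module.Projective A N)
    (hNB : Module.Projective Bᵐᵒᵖ N) {a : X →ₗ[A] U} {b : Y →ₗ[B] V} :
    IsGEpi (desc f a b) ↔
      Function.Surjective (a.coprod (f ∘ₗ BTensor.map A B N b)) ∧ IsGEpi b := by
  rw [← TriMod.isGEpi_map_iff hA hAN hNB (f := LinearMap.inr A X (BTensor A B N Y)) (f' := f)
    (h := by rw [LinearMap.coprod_inr]), ← desc_comp_equivTriMod_symm]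
  refine ⟨fun h => h.comp (isGEpi_equiv _), fun h => ?_⟩
  have := h.comp (isGEpi_equiv (equivTriMod A B N X Y))
  rwa [LinearMap.comp_assoc, LinearEquiv.symm_comp, LinearMap.comp_id] at this

theorem inGenG_iff_exists (hA : HasFiniteGlobalDimension A) (hAN : Module.Projective A N)
    (hNB : Module.Projective Bᵐᵒᵖ N) :
    InGenG (TriRing A B N) (TriSum A B N X Y) (TriMod f) ↔
      ∃ (I : Type u) (a : (I →₀ X) →ₗ[A] U) (b : (I →₀ Y) →ₗ[B] V),
        Function.Surjective (a.coprod (f ∘ₗ BTensor.map A B N b)) ∧ IsGEpi b := by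
  rw [inGenG_iff]
  refine exists_congr fun I => ?_
  obtain ⟨e⟩ := exists_finsuppEquiv (A := A) (B := B) (N := N) (X := X) (Y := Y) I
  constructor
  · rintro ⟨p, hp⟩
    obtain ⟨a, b, hab⟩ := exists_eq_desc (p ∘ₗ e.symm.toLinearMap)
    refine ⟨a, b, (isGEpi_desc_iff hA hAN hNB).1 ?_⟩
    rw [← hab]
    exact hp.comp (isGEpi_equiv _)
  · rintro ⟨a, b, h⟩
    exact ⟨_, ((isGEpi_desc_iff hA hAN hNB).2 h).comp (isGEpi_equiv e)⟩

/-- If `X` generates `N ⊗_B Y`, then `(U, V, f)` is generated by `(X, 0) ⊕ (N ⊗_B Y, Y)` if and only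
if `U` is generated by `X` and `V` by `Y`. -/
theorem inGenG_triMod_iff (hA : HasFiniteGlobalDimension A) (hAN : Module.Projective A N)
    (hNB : Module.Projective Bᵐᵒᵖ N) (hXY : InGenG A X (BTensor A B N Y)) :
    InGenG (TriRing A B N) (TriSum A B N X Y) (TriMod f) ↔ InGenG A X U ∧ InGenG B Y V := by
  rw [inGenG_iff_exists hA hAN hNB]
  constructor
  · rintro ⟨I, a, b, hab, hb⟩
    refine ⟨hA.inGenG_iff.2 (top_le_iff.1 fun u _ => ?_), inGenG_iff.2 ⟨I, b, hb⟩⟩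
    obtain ⟨⟨x, t⟩, rfl⟩ := hab u
    rw [LinearMap.coprod_apply]
    refine Submodule.add_mem _ (finsupp_apply_mem_traceSubmodule a x) ?_
    exact map_mem_traceSubmodule (traceSubmodule_bTensor_eq_top hXY.traceSubmodule_eq_top
      (InAdd.inGenG (inAdd_finsupp I)).traceSubmodule_eq_top) (f ∘ₗ BTensor.map A B N b) t
  · rintro ⟨hU, hV⟩
    obtain ⟨I, a, ha⟩ := inGenG_iff.1 hU
    obtain ⟨J, b, hb⟩ := inGenG_iff.1 hV
    refine ⟨I ⊕ J, a ∘ₗ Finsupp.lcomapDomain Sum.inl Sum.inl_injective, _, fun u => ?_,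
      hb.comp_lcomapDomain Sum.inr Sum.inr_injective⟩
    obtain ⟨x, hx⟩ := (ha.comp_lcomapDomain (J := I ⊕ J) Sum.inl Sum.inl_injective).1 u
    exact ⟨(x, 0), by rw [LinearMap.coprod_apply, LinearMap.map_zero, add_zero, hx]⟩

theorem inGenG_of_inGenG_triZ (hA : HasFiniteGlobalDimension A) (hAN : Module.Projective A N)
    (hNB : Module.Projective Bᵐᵒᵖ N)
    (h : InGenG (TriRing A B N) (TriSum A B N X Y) (TriZ A B N U)) : InGenG A X U := by
  obtain ⟨I, a, b, hab, -⟩ := (inGenG_iff_exists hA hAN hNB).1 h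
  refine inGenG_iff.2 ⟨I, a, hA.isGEpi_iff.2 fun u => ?_⟩
  obtain ⟨⟨x, t⟩, rfl⟩ := hab u
  exact ⟨x, by simp⟩

/-! ### Triangular presentations of `(X, 0) ⊕ (N ⊗_B Y, Y)` -/

/-- A map `(X, 0) ⊕ (N ⊗_B Y, Y) → (X', 0) ⊕ (N ⊗_B Y', Y')` is a triangular matrix with entries
`a : X → X'`, `b : X → N ⊗_B Y'` and `c : Y → Y'`. -/
theorem exists_components (θ : TriSum A B N X Y →ₗ[TriRing A B N] TriSum A B N X' Y') :
    ∃ (a : X →ₗ[A] X') (b : X →ₗ[A] BTensor A B N Y') (c : Y →ₗ[B] Y'),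
      (equivTriMod A B N X' Y').toLinearMap ∘ₗ θ = desc (LinearMap.inr A X' _) (a.prod b) c := by
  obtain ⟨d, c, h⟩ := exists_eq_desc ((equivTriMod A B N X' Y').toLinearMap ∘ₗ θ)
  exact ⟨LinearMap.fst A _ _ ∘ₗ d, LinearMap.snd A _ _ ∘ₗ d, c, by rw [h]; rfl⟩

theorem components_map (φ : X →ₗ[A] X') (ψ : Y →ₗ[B] Y') :
    (equivTriMod A B N X' Y').toLinearMap ∘ₗ map A B N φ ψ =
      desc (LinearMap.inr A X' _) (φ.prod 0) ψ := by
  rw [equivTriMod_comp_map]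
  refine LinearMap.ext fun m => TriMod.ext (Prod.ext ?_ ?_) ?_
  · exact (LinearMap.map_add φ m.1.1 0).trans (congrArg (φ m.1.1 + ·) (LinearMap.map_zero φ))
  · exact congrArg (BTensor.map A B N ψ) (zero_add m.2.1) |>.trans (zero_add _).symm
  · exact (LinearMap.map_add ψ 0 m.2.2).trans (congrArg (· + ψ m.2.2) (LinearMap.map_zero ψ))

theorem desc_comp_of_components {θ : TriSum A B N X Y →ₗ[TriRing A B N] TriSum A B N X' Y'}
    {a : X →ₗ[A] X'} {b : X →ₗ[A] BTensor A B N Y'} {c : Y →ₗ[B] Y'}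
    (hθ : (equivTriMod A B N X' Y').toLinearMap ∘ₗ θ = desc (LinearMap.inr A X' _) (a.prod b) c)
    (u : X' →ₗ[A] U) (v : Y' →ₗ[B] V) :
    desc f u v ∘ₗ θ = desc f (u ∘ₗ a + f ∘ₗ BTensor.map A B N v ∘ₗ b) (v ∘ₗ c) := by
  have h : desc f u v ∘ₗ θ = (desc f u v ∘ₗ (equivTriMod A B N X' Y').symm.toLinearMap) ∘ₗ
      (equivTriMod A B N X' Y').toLinearMap ∘ₗ θ := by
    refine LinearMap.ext fun m => ?_
    simp only [LinearMap.comp_apply, LinearEquiv.coe_coe, LinearEquiv.symm_apply_apply]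
  rw [h, hθ, desc_comp_equivTriMod_symm, map_comp_desc, LinearMap.coprod_comp_prod,
    LinearMap.comp_assoc]

theorem conj_eq_of_components {θ : TriSum A B N X Y →ₗ[TriRing A B N] TriSum A B N X' Y'}
    {a : X →ₗ[A] X'} {b : X →ₗ[A] BTensor A B N Y'} {c : Y →ₗ[B] Y'}
    (hθ : (equivTriMod A B N X' Y').toLinearMap ∘ₗ θ = desc (LinearMap.inr A X' _) (a.prod b) c) :
    (equivTriMod A B N X' Y').toLinearMap ∘ₗ θ =
      TriMod.map ((a.prod b).coprod (LinearMap.inr A X' _ ∘ₗ BTensor.map A B N c)) c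
        (by rw [LinearMap.coprod_inr]) ∘ₗ (equivTriMod A B N X Y).toLinearMap := by
  rw [hθ, ← desc_comp_equivTriMod_symm, LinearMap.comp_assoc, LinearEquiv.symm_comp,
    LinearMap.comp_id]

/-- The diagonal entries of a `G`-exact sequence of triangular matrices form an exact sequence of
`A`-modules and a `G`-exact sequence of `B`-modules. -/
theorem isGExact_components (hA : HasFiniteGlobalDimension A) (hAN : Module.Projective A N)
    (hNB : Module.Projective Bᵐᵒᵖ N)
    {θ : TriSum A B N X Y →ₗ[TriRing A B N] TriSum A B N X' Y'}
    {π : TriSum A B N X' Y' →ₗ[TriRing A B N] TriSum A B N X'' Y''}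
    {a : X →ₗ[A] X'} {b : X →ₗ[A] BTensor A B N Y'} {c : Y →ₗ[B] Y'}
    (hθ : (equivTriMod A B N X' Y').toLinearMap ∘ₗ θ = desc (LinearMap.inr A X' _) (a.prod b) c)
    {p : X' →ₗ[A] X''} {q : X' →ₗ[A] BTensor A B N Y''} {r : Y' →ₗ[B] Y''}
    (hπ : (equivTriMod A B N X'' Y'').toLinearMap ∘ₗ π =
      desc (LinearMap.inr A X'' _) (p.prod q) r) (H : IsGExact θ π) :
    (Function.Exact a p ∧ Function.Surjective p) ∧ IsGExact c r ∧
      q ∘ₗ a + BTensor.map A B N r ∘ₗ b = 0 := by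
  obtain ⟨⟨hex, hs⟩, hcr⟩ := (TriMod.isGExact_map_iff hA hAN hNB).1
    (H.congr _ _ _ (conj_eq_of_components hθ) (conj_eq_of_components hπ))
  have hcomp : ∀ x, p (a x) = 0 ∧ q (a x) + BTensor.map A B N r (b x) = 0 := fun x => by
    have := hex.apply_apply_eq_zero (x, 0)
    simpa [Prod.ext_iff] using this
  refine ⟨⟨fun x => ⟨fun hx => ?_, ?_⟩, fun z => ?_⟩, hcr, LinearMap.ext fun x => (hcomp x).2⟩
  · -- Since `Id_N ⊗ r` is onto, the lower entry of `π` at `x` can be cancelled.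
    obtain ⟨t, ht⟩ := BTensor.map_surjective (A := A) (N := N) hcr.surjective (q x)
    obtain ⟨y, hy⟩ := (hex (x, -t)).1 (by simp [hx, ht])
    refine ⟨y.1, ?_⟩
    have := congrArg Prod.fst hy
    simpa using this
  · rintro ⟨y, rfl⟩
    exact (hcomp y).1
  · obtain ⟨y, hy⟩ := hs (z, 0)
    refine ⟨y.1, ?_⟩
    have := congrArg Prod.fst hy
    simpa using this

theorem isGExact_map (hA : HasFiniteGlobalDimension A) (hAN : Module.Projective A N)
    (hNB : Module.Projective Bᵐᵒᵖ N) {φ : X →ₗ[A] X'} {φ' : X' →ₗ[A] X''} {ψ : Y →ₗ[B] Y'}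
    {ψ' : Y' →ₗ[B] Y''} (hφ : Function.Exact φ φ') (hφ' : Function.Surjective φ')
    (hψ : IsGExact ψ ψ') : IsGExact (map A B N φ ψ) (map A B N φ' ψ') := by
  have h : IsGExact (TriMod.map _ _ (prodMap_compat (N := N) φ ψ))
      (TriMod.map _ _ (prodMap_compat (N := N) φ' ψ')) :=
    (TriMod.isGExact_map_iff hA hAN hNB).2
      ⟨⟨exact_prodMap hφ (BTensor.map_exact hNB hψ.1),
        hφ'.prodMap (BTensor.map_surjective hψ.surjective)⟩, hψ⟩
  refine h.congr (equivTriMod A B N X Y).symm (equivTriMod A B N X' Y').symm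
    (equivTriMod A B N X'' Y'').symm ?_ ?_
  · refine LinearMap.ext fun m => (equivTriMod A B N X' Y').injective ?_
    have := LinearMap.congr_fun (equivTriMod_comp_map (N := N) φ ψ)
      ((equivTriMod A B N X Y).symm m)
    simp only [LinearMap.comp_apply, LinearEquiv.coe_coe, LinearEquiv.apply_symm_apply] at this ⊢
    exact this.symm
  · refine LinearMap.ext fun m => (equivTriMod A B N X'' Y'').injective ?_
    have := LinearMap.congr_fun (equivTriMod_comp_map (N := N) φ' ψ')
      ((equivTriMod A B N X' Y').symm m)
    simp only [LinearMap.comp_apply, LinearEquiv.coe_coe, LinearEquiv.apply_symm_apply] at this ⊢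
    exact this.symm

/-- The class `D_θ` of a triangular presentation `θ` depends only on the diagonal entries `a` and
`c`: a map `E₀ → V` killing `c` factors through `r`, and then its contribution to the off-diagonal
part factors through `a`, because `π ∘ θ = 0`. -/
theorem inD_triMod_iff {θ : TriSum A B N X Y →ₗ[TriRing A B N] TriSum A B N X' Y'}
    {a : X →ₗ[A] X'} {b : X →ₗ[A] BTensor A B N Y'} {c : Y →ₗ[B] Y'}
    (hθ : (equivTriMod A B N X' Y').toLinearMap ∘ₗ θ = desc (LinearMap.inr A X' _) (a.prod b) c)
    {q : X' →ₗ[A] BTensor A B N Y''} {r : Y' →ₗ[B] Y''} (hcr : Function.Exact c r)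
    (hr : Function.Surjective r) (hq : q ∘ₗ a + BTensor.map A B N r ∘ₗ b = 0) :
    InD θ (TriMod f) ↔ InD a U ∧ InD c V := by
  constructor
  · refine fun H => ⟨fun u => ?_, fun v => ?_⟩
    · obtain ⟨g, hg⟩ := H (desc f u 0)
      obtain ⟨u', v', rfl⟩ := exists_eq_desc g
      rw [desc_comp_of_components hθ, desc_inj] at hg
      obtain ⟨w, rfl⟩ := hcr.exists_desc_of_surjective hr v' hg.2
      refine ⟨u' - f ∘ₗ BTensor.map A B N w ∘ₗ q, ?_⟩
      have hq' : BTensor.map A B N r ∘ₗ b = -(q ∘ₗ a) := eq_neg_of_add_eq_zero_right hq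
      rw [BTensor.map_comp, LinearMap.comp_assoc, hq', LinearMap.comp_neg, LinearMap.comp_neg,
        ← sub_eq_add_neg] at hg
      rw [LinearMap.sub_comp, LinearMap.comp_assoc, LinearMap.comp_assoc]
      exact hg.1
    · obtain ⟨g, hg⟩ := H (desc f 0 v)
      obtain ⟨u', v', rfl⟩ := exists_eq_desc g
      rw [desc_comp_of_components hθ, desc_inj] at hg
      exact ⟨v', hg.2⟩
  · rintro ⟨hU, hV⟩ g
    obtain ⟨u, v, rfl⟩ := exists_eq_desc g
    obtain ⟨v', rfl⟩ := hV v
    obtain ⟨u', hu'⟩ := hU (u - f ∘ₗ BTensor.map A B N v' ∘ₗ b)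
    refine ⟨desc f u' v', ?_⟩
    rw [desc_comp_of_components hθ, hu', sub_add_cancel]

end TriSum

end RelativeTri

/-! ### Silting and approximations over the triangular matrix ring -/

section Silting

theorem InD.of_subsingleton {R : Type u} [Ring R] {G₁ G₀ M : Type u} [AddCommGroup G₁] [Module R G₁]
    [AddCommGroup G₀] [Module R G₀] [AddCommGroup M] [Module R M] [Subsingleton M]
    (θ : G₁ →ₗ[R] G₀) : InD θ M :=
  fun _ => ⟨0, Subsingleton.elim _ _⟩

theorem inD_prod_iff {R : Type u} [Ring R] {G₁ G₀ M M' : Type u} [AddCommGroup G₁] [Module R G₁]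
    [AddCommGroup G₀] [Module R G₀] [AddCommGroup M] [Module R M] [AddCommGroup M'] [Module R M']
    {θ : G₁ →ₗ[R] G₀} : InD θ (M × M') ↔ InD θ M ∧ InD θ M' := by
  refine ⟨fun h => ⟨fun f => ?_, fun f => ?_⟩, fun h f => ?_⟩
  · obtain ⟨g, hg⟩ := h (f.prod 0)
    exact ⟨LinearMap.fst R M M' ∘ₗ g, by rw [LinearMap.comp_assoc, hg]; rfl⟩
  · obtain ⟨g, hg⟩ := h (LinearMap.prod 0 f)
    exact ⟨LinearMap.snd R M M' ∘ₗ g, by rw [LinearMap.comp_assoc, hg]; rfl⟩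
  · obtain ⟨g, hg⟩ := h.1 (LinearMap.fst R M M' ∘ₗ f)
    obtain ⟨g', hg'⟩ := h.2 (LinearMap.snd R M M' ∘ₗ f)
    exact ⟨g.prod g', LinearMap.ext fun x =>
      Prod.ext (LinearMap.congr_fun hg x) (LinearMap.congr_fun hg' x)⟩

variable {A B N : Type u} [Ring A] [Ring B] [AddCommGroup N] [Module A N] [Module Bᵐᵒᵖ N]
  [SMulCommClass A Bᵐᵒᵖ N]
variable {X Y P₁ P₀ E₁ E₀ : Type u} [AddCommGroup X] [Module A X] [AddCommGroup Y] [Module B Y]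
  [AddCommGroup P₁] [Module A P₁] [AddCommGroup P₀] [Module A P₀]
  [AddCommGroup E₁] [Module B E₁] [AddCommGroup E₀] [Module B E₀]
  {G₁ G₀ : Type u} [AddCommGroup G₁] [Module (TriRing A B N) G₁] [AddCommGroup G₀]
  [Module (TriRing A B N) G₀]

/-- The class `D_θ` of `Γ`-modules is determined by the classes `D_a` and `D_c` of `A`- and
`B`-modules: a triple `(U, V, f)` belongs to `D_θ` if and only if `U` belongs to `D_a` and `V`
to `D_c`. -/
def IsComponentwiseD (θ : G₁ →ₗ[TriRing A B N] G₀) (a : P₁ →ₗ[A] P₀) (c : E₁ →ₗ[B] E₀) : Prop :=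
  ∀ (U V : Type u) [AddCommGroup U] [Module A U] [AddCommGroup V] [Module B V]
    (f : BTensor A B N V →ₗ[A] U), InD θ (TriMod f) ↔ InD a U ∧ InD c V

namespace IsComponentwiseD

variable {θ : G₁ →ₗ[TriRing A B N] G₀} {a : P₁ →ₗ[A] P₀} {c : E₁ →ₗ[B] E₀}

theorem inD_triSum_iff (hD : IsComponentwiseD θ a c) (X Y : Type u) [AddCommGroup X] [Module A X]
    [AddCommGroup Y] [Module B Y] :
    InD θ (TriSum A B N X Y) ↔ (InD a X ∧ InD a (BTensor A B N Y)) ∧ InD c Y := by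
  rw [← inD_prod_iff, ← hD (f := LinearMap.inr A X (BTensor A B N Y))]
  exact ⟨fun h => h.of_equiv (TriSum.equivTriMod A B N X Y),
    fun h => h.of_equiv (TriSum.equivTriMod A B N X Y).symm⟩

theorem inD_triZ_iff (hD : IsComponentwiseD θ a c) (U : Type u) [AddCommGroup U] [Module A U] :
    InD θ (TriZ A B N U) ↔ InD a U :=
  (hD _ _ _).trans (and_iff_left (.of_subsingleton c))

theorem gen_eq_iff (hD : IsComponentwiseD θ a c) (hA : HasFiniteGlobalDimension A)
    (hAN : Module.Projective A N) (hNB : Module.Projective Bᵐᵒᵖ N) :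
    (∀ M : ModuleCat.{u} (TriRing A B N),
        InGenG (TriRing A B N) (TriSum A B N X Y) M ↔ InD θ M) ↔
      (∀ U : ModuleCat.{u} A, InGenG A X U ↔ InD a U) ∧ InGenG A X (BTensor A B N Y) ∧
        ∀ V : ModuleCat.{u} B, InGenG B Y V ↔ InD c V := by
  constructor
  · intro H
    have hXY : InGenG A X (BTensor A B N Y) := by
      have h1 := ((hD.inD_triSum_iff X Y).1
        ((H (ModuleCat.of _ (TriSum A B N X Y))).1 inGenG_self)).1.2
      exact TriSum.inGenG_of_inGenG_triZ hA hAN hNB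
        ((H (ModuleCat.of _ (TriZ A B N (BTensor A B N Y)))).2 ((hD.inD_triZ_iff _).2 h1))
    have hM : ∀ (U : ModuleCat.{u} A) (V : ModuleCat.{u} B) (f : BTensor A B N V →ₗ[A] U),
        (InGenG A X U ∧ InGenG B Y V) ↔ (InD a U ∧ InD c V) := fun U V f => by
      rw [← TriSum.inGenG_triMod_iff (f := f) hA hAN hNB hXY, ← hD _ _ f]
      exact H (ModuleCat.of _ (TriMod f))
    have h0 : ∀ (R : Type u) [Ring R] (T : Type u) [AddCommGroup T] [Module R T],
        InGenG R T (ModuleCat.of R PUnit.{u + 1}) := fun R _ T _ _ => InAdd.inGenG inAdd_punit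
    refine ⟨fun U => ?_, hXY, fun V => ?_⟩
    · have h1 := hM U (ModuleCat.of B PUnit.{u + 1}) 0
      rwa [and_iff_left (h0 B Y), and_iff_left (.of_subsingleton c)] at h1
    · have h1 := hM (ModuleCat.of A PUnit.{u + 1}) V 0
      rwa [and_iff_right (h0 A X), and_iff_right (.of_subsingleton a)] at h1
  · rintro ⟨hX, hXY, hY⟩ M
    obtain ⟨U, V, f, ⟨e⟩⟩ := TriMod.exists_equiv (A := A) (B := B) (N := N) M
    have h1 : InGenG (TriRing A B N) (TriSum A B N X Y) (TriMod f) ↔ InD θ (TriMod f) := by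
      rw [TriSum.inGenG_triMod_iff hA hAN hNB hXY, hD, hX, hY]
    exact ⟨fun h => (h1.1 (h.of_equiv e)).of_equiv e.symm,
      fun h => (h1.2 (h.of_equiv e)).of_equiv e.symm⟩

theorem isLeftDApprox_iff (hD : IsComponentwiseD θ a c) {P X₀ E Y₀ : Type u} [AddCommGroup P]
    [Module A P] [AddCommGroup X₀] [Module A X₀] [AddCommGroup E] [Module B E] [AddCommGroup Y₀]
    [Module B Y₀] {φ : P →ₗ[A] X₀} {ψ : E →ₗ[B] Y₀} :
    IsLeftDApprox θ (TriSum.map A B N φ ψ) ↔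
      IsLeftDApprox a φ ∧ InD a (BTensor A B N Y₀) ∧ IsLeftDApprox c ψ := by
  constructor
  · rintro ⟨h0, h⟩
    obtain ⟨⟨hX₀, hN⟩, hY₀⟩ := (hD.inD_triSum_iff _ _).1 h0
    refine ⟨⟨hX₀, fun U hU u => ?_⟩, hN, hY₀, fun V hV v => ?_⟩
    · obtain ⟨g, hg⟩ := h (ModuleCat.of _ (TriZ A B N U)) ((hD.inD_triZ_iff _).2 hU)
        (TriSum.desc _ u 0)
      obtain ⟨u', v', rfl⟩ := TriSum.exists_eq_desc
        (f := (0 : BTensor A B N PUnit.{u + 1} →ₗ[A] U)) g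
      rw [TriSum.desc_comp_map] at hg
      exact ⟨u', (TriSum.desc_inj.1 hg).1⟩
    · obtain ⟨g, hg⟩ := h
        (ModuleCat.of _ (TriMod (0 : BTensor A B N V →ₗ[A] PUnit.{u + 1})))
        ((hD _ _ _).2 ⟨.of_subsingleton a, hV⟩) (TriSum.desc _ 0 v)
      obtain ⟨u', v', rfl⟩ := TriSum.exists_eq_desc
        (f := (0 : BTensor A B N V →ₗ[A] PUnit.{u + 1})) g
      rw [TriSum.desc_comp_map] at hg
      exact ⟨v', (TriSum.desc_inj.1 hg).2⟩
  · rintro ⟨⟨hX₀, h⟩, hN, hY₀, h'⟩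
    refine ⟨(hD.inD_triSum_iff _ _).2 ⟨⟨hX₀, hN⟩, hY₀⟩, fun M hM g => ?_⟩
    obtain ⟨U, V, f, ⟨e⟩⟩ := TriMod.exists_equiv (A := A) (B := B) (N := N) M
    obtain ⟨hU, hV⟩ := (hD _ _ f).1 (hM.of_equiv e)
    obtain ⟨u, v, huv⟩ := TriSum.exists_eq_desc (e.toLinearMap ∘ₗ g)
    obtain ⟨u', rfl⟩ := h U hU u
    obtain ⟨v', rfl⟩ := h' V hV v
    refine ⟨e.symm.toLinearMap ∘ₗ TriSum.desc f u' v', ?_⟩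
    rw [LinearMap.comp_assoc, TriSum.desc_comp_map, ← huv]
    refine LinearMap.ext fun m => ?_
    simp only [LinearMap.comp_apply, LinearEquiv.coe_coe, LinearEquiv.symm_apply_apply]

theorem hasDiagonalApproxSequences_iff (hD : IsComponentwiseD θ a c)
    (hA : HasFiniteGlobalDimension A) (hAN : Module.Projective A N)
    (hNB : Module.Projective Bᵐᵒᵖ N) (hX : ∀ U : ModuleCat.{u} A, InGenG A X U ↔ InD a U)
    (hXY : InGenG A X (BTensor A B N Y)) :
    HasDiagonalApproxSequences A B N X Y θ ↔
      HasProjApproxSequences X a ∧ HasGPApproxSequences Y c := by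
  constructor
  · refine fun H => ⟨fun P hP => ?_, fun E hE => ?_⟩
    · obtain ⟨X₀, X₁, Y₀, Y₁, φ, ψ, μ, hX₀, hX₁, -, -, hex, happ⟩ := H P
        (ModuleCat.of B PUnit.{u + 1}) (isGorensteinProjective_triSum hNB hP
          (isGorensteinProjective_of_projective inferInstance))
      obtain ⟨p, q, r, hμ⟩ := TriSum.exists_components μ
      obtain ⟨⟨h1, h2⟩, -⟩ := TriSum.isGExact_components hA hAN hNB
        (TriSum.components_map φ ψ) hμ hex
      exact ⟨X₀, X₁, φ, p, hX₀, hX₁, h1, h2, (hD.isLeftDApprox_iff.1 happ).1⟩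
    · obtain ⟨X₀, X₁, Y₀, Y₁, φ, ψ, μ, -, -, hY₀, hY₁, hex, happ⟩ := H
        (ModuleCat.of A PUnit.{u + 1}) E (isGorensteinProjective_triSum hNB inferInstance hE)
      obtain ⟨p, q, r, hμ⟩ := TriSum.exists_components μ
      obtain ⟨-, h1, -⟩ := TriSum.isGExact_components hA hAN hNB
        (TriSum.components_map φ ψ) hμ hex
      exact ⟨Y₀, Y₁, ψ, r, hY₀, hY₁, h1, (hD.isLeftDApprox_iff.1 happ).2.2⟩
  · rintro ⟨H, H'⟩ P E hPE
    obtain ⟨hP, hE⟩ := (isGorensteinProjective_triSum_iff hA hAN hNB).1 hPE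
    obtain ⟨X₀, X₁, φ, p, hX₀, hX₁, hex, hp, happ⟩ := H P hP
    obtain ⟨Y₀, Y₁, ψ, r, hY₀, hY₁, hψ, happ'⟩ := H' E hE
    have hN : InD a (BTensor A B N Y₀) :=
      (hX (ModuleCat.of A (BTensor A B N Y₀))).1 (hA.inGenG_iff.2
        (traceSubmodule_bTensor_eq_top hXY.traceSubmodule_eq_top
          hY₀.inGenG.traceSubmodule_eq_top))
    exact ⟨X₀, X₁, Y₀, Y₁, φ, ψ, TriSum.map A B N p r, hX₀, hX₁, hY₀, hY₁,
      TriSum.isGExact_map hA hAN hNB hex hp hψ, hD.isLeftDApprox_iff.2 ⟨happ, hN, happ'⟩⟩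

end IsComponentwiseD

theorem InD.of_equiv_presentation {R : Type u} [Ring R] {G₁ G₀ G₁' G₀' M : Type u}
    [AddCommGroup G₁] [Module R G₁] [AddCommGroup G₀] [Module R G₀] [AddCommGroup G₁']
    [Module R G₁'] [AddCommGroup G₀'] [Module R G₀'] [AddCommGroup M] [Module R M]
    {θ : G₁ →ₗ[R] G₀} {θ' : G₁' →ₗ[R] G₀'} (e₁ : G₁ ≃ₗ[R] G₁') (e₀ : G₀ ≃ₗ[R] G₀')
    (h : e₀.toLinearMap ∘ₗ θ = θ' ∘ₗ e₁.toLinearMap) (hM : InD θ M) : InD θ' M := by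
  intro f
  obtain ⟨g, hg⟩ := hM (f ∘ₗ e₁.toLinearMap)
  refine ⟨g ∘ₗ e₀.symm.toLinearMap, LinearMap.ext fun x => ?_⟩
  have h1 := LinearMap.congr_fun h (e₁.symm x)
  have h2 := LinearMap.congr_fun hg (e₁.symm x)
  simp only [LinearMap.comp_apply, LinearEquiv.coe_coe, LinearEquiv.apply_symm_apply] at h1 h2 ⊢
  rw [← h1, LinearEquiv.symm_apply_apply, h2]

end Silting

end

theorem theorem4p6 {A B N : Type u} [Ring A] [Ring B] [AddCommGroup N] [Module A N]
    [Module Bᵐᵒᵖ N] [SMulCommClass A Bᵐᵒᵖ N]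
    (hΓ : IsGorensteinRing (TriRing A B N)) (hA : HasFiniteGlobalDimension A)
    (hAN : Module.Projective A N) (hNB : Module.Projective Bᵐᵒᵖ N)
    (X Y : Type u) [AddCommGroup X] [Module A X] [AddCommGroup Y] [Module B Y] :
    -- the equivalence, with witnessing presentations
    ((∃ (G₁ G₀ : ModuleCat.{u} (TriRing A B N)) (θ : G₁ →ₗ[TriRing A B N] G₀)
        (π : G₀ →ₗ[TriRing A B N] TriSum A B N X Y),
        IsGorensteinSiltingWrt θ π ∧ HasDiagonalApproxSequences A B N X Y θ) ↔
      ((∃ (P₁ P₀ : ModuleCat.{u} A) (θX : P₁ →ₗ[A] P₀) (πX : P₀ →ₗ[A] X),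
          IsGorensteinSiltingWrt θX πX ∧ HasProjApproxSequences X θX) ∧
        InGenG A X (BTensor A B N Y) ∧
        (∃ (E₁ E₀ : ModuleCat.{u} B) (θY : E₁ →ₗ[B] E₀) (πY : E₀ →ₗ[B] Y),
          IsGorensteinSiltingWrt θY πY ∧ HasGPApproxSequences Y θY))) ∧
    -- the equivalence with respect to given presentations of `X` and `Y`
    (∀ (P₁ P₀ : ModuleCat.{u} A) (θX : P₁ →ₗ[A] P₀) (πX : P₀ →ₗ[A] X)
        (E₁ E₀ : ModuleCat.{u} B) (θY : E₁ →ₗ[B] E₀) (πY : E₀ →ₗ[B] Y),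
      Module.Projective A P₁ → Module.Projective A P₀ →
      Function.Exact θX πX → Function.Surjective πX →
      IsProperGPPresentation θY πY →
      ((IsGorensteinSiltingWrt (TriSum.map A B N θX θY) (TriSum.map A B N πX πY) ∧
          HasDiagonalApproxSequences A B N X Y (TriSum.map A B N θX θY)) ↔
        (IsGorensteinSiltingWrt θX πX ∧ InGenG A X (BTensor A B N Y) ∧
          IsGorensteinSiltingWrt θY πY ∧
          HasProjApproxSequences X θX ∧ HasGPApproxSequences Y θY))) := by

  -- The equivalence for diagonal presentations.
  have diag : ∀ (P₁ P₀ : ModuleCat.{u} A) (θX : P₁ →ₗ[A] P₀) (πX : P₀ →ₗ[A] X)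
      (E₁ E₀ : ModuleCat.{u} B) (θY : E₁ →ₗ[B] E₀) (πY : E₀ →ₗ[B] Y),
      Module.Projective A P₁ → Module.Projective A P₀ →
      Function.Exact θX πX → Function.Surjective πX →
      IsProperGPPresentation θY πY →
      ((IsGorensteinSiltingWrt (TriSum.map A B N θX θY) (TriSum.map A B N πX πY) ∧
          HasDiagonalApproxSequences A B N X Y (TriSum.map A B N θX θY)) ↔
        (IsGorensteinSiltingWrt θX πX ∧ InGenG A X (BTensor A B N Y) ∧
          IsGorensteinSiltingWrt θY πY ∧
          HasProjApproxSequences X θX ∧ HasGPApproxSequences Y θY)) := by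
    intro P₁ P₀ θX πX E₁ E₀ θY πY hP₁ hP₀ hex hs hY
    have hD : IsComponentwiseD (TriSum.map A B N θX θY) θX θY := fun U V _ _ _ _ f =>
      TriSum.inD_triMod_iff (TriSum.components_map θX θY) (q := (0 : P₀ →ₗ[A] BTensor A B N Y))
        hY.2.2.1 hY.2.2.surjective (by rw [LinearMap.zero_comp, LinearMap.comp_zero, add_zero])
    have hpX : IsProperGPPresentation θX πX :=
      ⟨isGorensteinProjective_of_projective hP₁, isGorensteinProjective_of_projective hP₀,
        hA.isGExact_iff.2 ⟨hex, hs⟩⟩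
    have hp : IsProperGPPresentation (TriSum.map A B N θX θY) (TriSum.map A B N πX πY) :=
      ⟨isGorensteinProjective_triSum hNB hP₁ hY.1, isGorensteinProjective_triSum hNB hP₀ hY.2.1,
        TriSum.isGExact_map hA hAN hNB hex hs hY.2.2⟩
    constructor
    · rintro ⟨⟨-, hgen⟩, happ⟩
      obtain ⟨h1, h2, h3⟩ := (hD.gen_eq_iff hA hAN hNB).1 hgen
      exact ⟨⟨hpX, h1⟩, h2, ⟨hY, h3⟩,
        (hD.hasDiagonalApproxSequences_iff hA hAN hNB h1 h2).1 happ⟩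
    · rintro ⟨⟨-, h1⟩, h2, ⟨-, h3⟩, happ⟩
      exact ⟨⟨hp, (hD.gen_eq_iff hA hAN hNB).2 ⟨h1, h2, h3⟩⟩,
        (hD.hasDiagonalApproxSequences_iff hA hAN hNB h1 h2).2 happ⟩
  refine ⟨⟨?_, ?_⟩, diag⟩
  · -- A presentation is isomorphic to a triangular one, and its class `D_θ` depends only on the
    -- diagonal entries, which present `X` and `Y`.
    rintro ⟨G₁, G₀, θ, π, ⟨⟨hG₁, hG₀, hex⟩, hgen⟩, happ⟩
    obtain ⟨P₁, E₁, hP₁, hE₁, ⟨e₁⟩⟩ := hG₁.exists_equiv_triSum hA hAN hNB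
    obtain ⟨P₀, E₀, hP₀, hE₀, ⟨e₀⟩⟩ := hG₀.exists_equiv_triSum hA hAN hNB
    have hθ' : e₀.toLinearMap ∘ₗ θ =
        (e₀.toLinearMap ∘ₗ θ ∘ₗ e₁.symm.toLinearMap) ∘ₗ e₁.toLinearMap :=
      LinearMap.ext fun x => by simp
    have hπ' : (LinearEquiv.refl _ _).toLinearMap ∘ₗ π =
        (π ∘ₗ e₀.symm.toLinearMap) ∘ₗ e₀.toLinearMap :=
      LinearMap.ext fun x => by simp
    obtain ⟨a, b, c, hθ⟩ := TriSum.exists_components (e₀.toLinearMap ∘ₗ θ ∘ₗ e₁.symm.toLinearMap)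
    obtain ⟨p, q, r, hπ⟩ := TriSum.exists_components (π ∘ₗ e₀.symm.toLinearMap)
    obtain ⟨⟨hap, hp⟩, hcr, hq⟩ := TriSum.isGExact_components hA hAN hNB hθ hπ
      (hex.congr e₁ e₀ (LinearEquiv.refl _ _) hθ' hπ')
    have hD : IsComponentwiseD θ a c := fun U V _ _ _ _ f => by
      rw [← TriSum.inD_triMod_iff hθ hcr.1 hcr.surjective hq]
      refine ⟨InD.of_equiv_presentation e₁ e₀ hθ', InD.of_equiv_presentation e₁.symm e₀.symm ?_⟩
      exact LinearMap.ext fun x => by simp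
    obtain ⟨h1, h2, h3⟩ := (hD.gen_eq_iff hA hAN hNB).1 hgen
    obtain ⟨h4, h5⟩ := (hD.hasDiagonalApproxSequences_iff hA hAN hNB h1 h2).1 happ
    exact ⟨⟨P₁, P₀, a, p, ⟨⟨isGorensteinProjective_of_projective hP₁,
      isGorensteinProjective_of_projective hP₀, hA.isGExact_iff.2 ⟨hap, hp⟩⟩, h1⟩, h4⟩, h2,
      E₁, E₀, c, r, ⟨⟨hE₁, hE₀, hcr⟩, h3⟩, h5⟩
  · rintro ⟨⟨P₁, P₀, θX, πX, hX, happX⟩, hXY, E₁, E₀, θY, πY, hY, happY⟩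
    have h := (diag P₁ P₀ θX πX E₁ E₀ θY πY
      (hA.projective_of_isGorensteinProjective hX.1.1)
      (hA.projective_of_isGorensteinProjective hX.1.2.1) hX.1.2.2.1 hX.1.2.2.surjective hY.1).2
      ⟨hX, hXY, hY, happX, happY⟩
    exact ⟨ModuleCat.of _ (TriSum A B N P₁ E₁), ModuleCat.of _ (TriSum A B N P₀ E₀), _, _, h⟩
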